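/- Let $(M^n,g)$, $n\ge 4$, be a complete smooth Riemannian manifold and let $f\in C^\infty(M)$ and $\rho>0$ satisfy the gradient shrinking Ricci soliton equation $r_g+Ddf=\rho g$, where $r_g$ is the Ricci tensor, $D$ the Levi-Civita connection and $Ddf$ the Hessian of $f$. Let $\mathcal W$ be the Weyl tensor, let $\delta\mathcal W(X,Y,Z)=-\sum_a (D_{e_a}\mathcal W)(e_a,X,Y,Z)$ be its divergence (for an orthonormal basis $e_a$), and assume that $\delta\mathcal W(X,Y,\nabla f)=0$ for all tangent vectors $X,Y$. The curvature tensor $R$ is normalized so that $R(X,Y,X,Y)$ is the sectional curvature of the plane spanned by orthonormal $X,Y$, i.e. $R(X,Y,Z,V)=g(D_{[X,Y]}Z-[D_X,D_Y]Z,\,V)$. Then, at every point of $M$: 1. $r_g(X,\nabla f)=0$ for every tangent vector $X\perp\nabla f$; 2. $R(X,\nabla f,Y,\nabla f)=0$ for all unit tangent vectors $X,Y\perp\nabla f$ with $X\perp Y$; 3. $\displaystyle R(X,\nabla f,X,\nabla f)=\frac{1}{n-1}\,r_g(\nabla f,\nabla f)=\frac{\alpha|\nabla f|^2}{n-1}$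 for every unit tangent vector $X\perp\nabla f$, where $\alpha=r_g(N,N)$ with $N=\nabla f/|\nabla f|$ wherever $\nabla f\ne0$ (at critical points of $f$ all three expressions vanish, whatever value is given to $\alpha$ there). -/

import Mathlib

open scoped Manifold ContDiff Bundle

noncomputable section

/-! ### Tensor calculus in coordinates

`G` is the matrix `(g_ij)` of a Riemannian metric as a function of the coordinates
`u ∈ ℝⁿ`. -/

namespace CoordMetric

variable {n : ℕ}

/-- The partial derivative `∂_i F` at `u`. -/
def pd (i : Fin n) (F : EuclideanSpace ℝ (Fin n) → ℝ) (u : EuclideanSpace ℝ (Fin n)) : ℝ :=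
  fderiv ℝ F u (EuclideanSpace.single i 1)

variable (G : EuclideanSpace ℝ (Fin n) → Matrix (Fin n) (Fin n) ℝ)

/-- The Christoffel symbol `Γ^k_ij` of the Levi-Civita connection, `D_{∂_i} ∂_j = Γ^k_ij ∂_k`. -/
def christoffel (k i j : Fin n) (u : EuclideanSpace ℝ (Fin n)) : ℝ :=
  (1 / 2) * ∑ l, (G u)⁻¹ k l *
    (pd i (fun v => G v j l) u + pd j (fun v => G v i l) u - pd l (fun v => G v i j) u)

/-- The components `R_ijk^l` of the curvature, `R(∂_i, ∂_j) ∂_k = R_ijk^l ∂_l`, with the sign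
convention `R(X, Y) Z = D_{[X, Y]} Z - (D_X D_Y Z - D_Y D_X Z)`. -/
def riemannUp (i j k l : Fin n) (u : EuclideanSpace ℝ (Fin n)) : ℝ :=
  pd j (christoffel G l i k) u - pd i (christoffel G l j k) u
    + ∑ m, (christoffel G m i k u * christoffel G l j m u
        - christoffel G m j k u * christoffel G l i m u)

/-- `R_ijkl = g(R(∂_i, ∂_j) ∂_k, ∂_l)`; thus `R(X, Y, X, Y)` is the sectional curvature of the
plane spanned by orthonormal `X`, `Y` (it is positive on round spheres). -/
def riemann (i j k l : Fin n) (u : EuclideanSpace ℝ (Fin n)) : ℝ :=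
  ∑ m, riemannUp G i j k m u * G u m l

/-- The Ricci curvature `r(X, Y) = tr (Z ↦ R(X, Z) Y)`, in components. -/
def ricci (i k : Fin n) (u : EuclideanSpace ℝ (Fin n)) : ℝ :=
  ∑ j, riemannUp G i j k j u

/-- The scalar curvature, the trace of the Ricci curvature. -/
def scalar (u : EuclideanSpace ℝ (Fin n)) : ℝ :=
  ∑ i, ∑ k, (G u)⁻¹ i k * ricci G i k u

/-- The trace-free part of the Ricci curvature. -/
def tracelessRicci (i k : Fin n) (u : EuclideanSpace ℝ (Fin n)) : ℝ :=
  ricci G i k u - scalar G u / n * G u i k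

/-- The Kulkarni-Nomizu product of two symmetric `2`-tensors. -/
def kulkarniNomizu (h h' : Fin n → Fin n → ℝ) (i j k l : Fin n) : ℝ :=
  h i k * h' j l + h j l * h' i k - h i l * h' j k - h j k * h' i l

/-- The Weyl tensor (for `n ≥ 3`): the remainder in the decomposition
`R = s / (2 n (n - 1)) (g ∧ g) + 1 / (n - 2) (r₀ ∧ g) + W`, with `∧` the Kulkarni-Nomizu product,
`s` the scalar curvature and `r₀` the trace-free Ricci curvature. -/
def weyl (i j k l : Fin n) (u : EuclideanSpace ℝ (Fin n)) : ℝ :=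
  riemann G i j k l u
    - scalar G u / (2 * n * ((n : ℝ) - 1)) * kulkarniNomizu (G u) (G u) i j k l
    - 1 / ((n : ℝ) - 2) *
        kulkarniNomizu (fun a b => tracelessRicci G a b u) (G u) i j k l

/-- The covariant derivative `(D_{∂_m} W)(∂_i, ∂_j, ∂_k, ∂_l)` of the Weyl tensor. -/
def covWeyl (m i j k l : Fin n) (u : EuclideanSpace ℝ (Fin n)) : ℝ :=
  pd m (weyl G i j k l) u
    - ∑ a, (christoffel G a m i u * weyl G a j k l u + christoffel G a m j u * weyl G i a k l u
        + christoffel G a m k u * weyl G i j a l u + christoffel G a m l u * weyl G i j k a u)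

/-- The divergence of the Weyl tensor,
`(δW)(X, Y, Z) = - ∑ (D_{e_a} W)(e_a, X, Y, Z)` over an orthonormal basis `e_a`. -/
def divWeyl (j k l : Fin n) (u : EuclideanSpace ℝ (Fin n)) : ℝ :=
  -∑ m, ∑ i, (G u)⁻¹ m i * covWeyl G m i j k l u

/-- The Hessian `Ddφ` of a function `φ`. -/
def hess (φ : EuclideanSpace ℝ (Fin n) → ℝ) (i j : Fin n) (u : EuclideanSpace ℝ (Fin n)) : ℝ :=
  pd i (pd j φ) u - ∑ k, christoffel G k i j u * pd k φ u

end CoordMetric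

/-! ### Tensors on a Riemannian manifold

The tensors below are evaluated on tangent vectors at a point `p`, through a smooth chart `e`
around `p` (the value does not depend on the chart). -/

namespace RiemMfd

variable {n : ℕ} {M : Type*} [TopologicalSpace M] [ChartedSpace (EuclideanSpace ℝ (Fin n)) M]

/-- `dxⁱ(X)`: the `i`-th component of the tangent vector `X` in the chart `e`. -/
def comp (e : OpenPartialHomeomorph M (EuclideanSpace ℝ (Fin n))) (p : M)
    (X : TangentSpace (𝓡 n) p) (i : Fin n) : ℝ :=
  (show EuclideanSpace ℝ (Fin n) from mfderiv (𝓡 n) 𝓘(ℝ, EuclideanSpace ℝ (Fin n)) e p X) i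

/-- The coordinate vector field `∂_i` of the chart `e`, at the point with coordinates `u`. -/
def coordVec (e : OpenPartialHomeomorph M (EuclideanSpace ℝ (Fin n)))
    (u : EuclideanSpace ℝ (Fin n)) (i : Fin n) : TangentSpace (𝓡 n) (e.symm u) :=
  mfderiv 𝓘(ℝ, EuclideanSpace ℝ (Fin n)) (𝓡 n) e.symm u
    (show EuclideanSpace ℝ (Fin n) from EuclideanSpace.single i 1)

variable [Bundle.RiemannianBundle (fun x : M => TangentSpace (𝓡 n) x)]

/-- The matrix `g_ij = g(∂_i, ∂_j)` of the Riemannian metric in the chart `e`. -/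
def metricIn (e : OpenPartialHomeomorph M (EuclideanSpace ℝ (Fin n)))
    (u : EuclideanSpace ℝ (Fin n)) : Matrix (Fin n) (Fin n) ℝ :=
  Matrix.of fun i j => inner ℝ (coordVec e u i) (coordVec e u j)

variable (e : OpenPartialHomeomorph M (EuclideanSpace ℝ (Fin n)))

/-- The curvature tensor `R(X, Y, Z, V)` at `p`. -/
def riemann (p : M) (X Y Z V : TangentSpace (𝓡 n) p) : ℝ :=
  ∑ i, ∑ j, ∑ k, ∑ l, CoordMetric.riemann (metricIn e) i j k l (e p) *
    (comp e p X i * comp e p Y j * comp e p Z k * comp e p V l)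

/-- The Ricci tensor `r(X, Y)` at `p`. -/
def ricci (p : M) (X Y : TangentSpace (𝓡 n) p) : ℝ :=
  ∑ i, ∑ j, CoordMetric.ricci (metricIn e) i j (e p) * (comp e p X i * comp e p Y j)

/-- The Hessian `Ddf(X, Y)` at `p`. -/
def hess (f : M → ℝ) (p : M) (X Y : TangentSpace (𝓡 n) p) : ℝ :=
  ∑ i, ∑ j, CoordMetric.hess (metricIn e) (fun u => f (e.symm u)) i j (e p) *
    (comp e p X i * comp e p Y j)

/-- The divergence `δW(X, Y, Z)` of the Weyl tensor at `p`. -/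
def divWeyl (p : M) (X Y Z : TangentSpace (𝓡 n) p) : ℝ :=
  ∑ i, ∑ j, ∑ k, CoordMetric.divWeyl (metricIn e) i j k (e p) *
    (comp e p X i * comp e p Y j * comp e p Z k)

/-- The gradient `∇f`, the vector field with `g(∇f, X) = df(X)`. -/
def grad (f : M → ℝ) (p : M) : TangentSpace (𝓡 n) p :=
  haveI : FiniteDimensional ℝ (TangentSpace (𝓡 n) p) :=
    inferInstanceAs (FiniteDimensional ℝ (EuclideanSpace ℝ (Fin n)))
  haveI : CompleteSpace (TangentSpace (𝓡 n) p) := FiniteDimensional.complete ℝ _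
  (InnerProductSpace.toDual ℝ (TangentSpace (𝓡 n) p)).symm (mfderiv (𝓡 n) 𝓘(ℝ, ℝ) f p)

/-- `α = r(N, N)` with `N = ∇f / |∇f|`, where `∇f ≠ 0`. (At critical points of `f` this has the
irrelevant value `0`.) -/
def radialRicci (f : M → ℝ) (p : M) : ℝ :=
  ricci e p (‖(grad f p : TangentSpace (𝓡 n) p)‖⁻¹ • grad f p)
    (‖(grad f p : TangentSpace (𝓡 n) p)‖⁻¹ • grad f p)

/-- `(M, g, f)` satisfies the gradient Ricci soliton equation `r + Ddf = ρ g`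
(as tensors on `M`, in all smooth charts). -/
def IsGradientRicciSoliton (n : ℕ) {M : Type*} [TopologicalSpace M]
    [ChartedSpace (EuclideanSpace ℝ (Fin n)) M]
    [Bundle.RiemannianBundle (fun x : M => TangentSpace (𝓡 n) x)]
    [IsManifold (𝓡 n) ∞ M] (f : M → ℝ) (ρ : ℝ) : Prop :=
  ∀ e ∈ IsManifold.maximalAtlas (𝓡 n) ∞ M, ∀ p ∈ e.source, ∀ X Y : TangentSpace (𝓡 n) p,
    ricci e p X Y + hess e f p X Y = ρ * inner ℝ X Y

/-- `δW(·, ·, ∇f) = 0` on `M`. -/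
def IsWeaklyHarmonicWeyl (n : ℕ) {M : Type*} [TopologicalSpace M]
    [ChartedSpace (EuclideanSpace ℝ (Fin n)) M]
    [Bundle.RiemannianBundle (fun x : M => TangentSpace (𝓡 n) x)]
    [IsManifold (𝓡 n) ∞ M] (f : M → ℝ) : Prop :=
  ∀ e ∈ IsManifold.maximalAtlas (𝓡 n) ∞ M, ∀ p ∈ e.source, ∀ X Y : TangentSpace (𝓡 n) p,
    divWeyl e p X Y (grad f p) = 0

end RiemMfd

end

/-! Everything follows from one identity, `riemann_grad_grad`: R(X,∇f,Y,∇f) = (r(∇f,∇f) g(X,Y) -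
r(X,∇f) g(Y,∇f)) / (n-1). By pair symmetry its left side is symmetric in X and Y, so r(X,∇f) g(Y,∇f)
is symmetric too. Taking Y = ∇f and X ⊥ ∇f gives r(X,∇f)|∇f|² = 0, the first claim. The other two
are read off by inserting X ⊥ Y, or X = Y of unit length, with both orthogonal to ∇f.

The identity is local and is proved in a chart. The second Bianchi identity shows that δW is
-(n-3)/(n-2) times the Cotton tensor (`divWeyl_eq`), that is, the skew derivative of the Ricci
tensor corrected by ds. On a soliton Dr = -D(Ddf), so the Ricci identity turns the skew derivative
of r into a contraction of R with ∇f (`cov₂_ricci_sub`), and its trace gives ds = 2 r(∇f,·)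
(`pd_scalar_soliton`). Contracting the Cotton tensor once more with ∇f then leaves only the terms of
the identity; as n - 3 ≠ 0, vanishing of δW(·,·,∇f) yields it. -/

noncomputable section

namespace CoordMetric

variable {n : ℕ}

/-! ### Partial derivatives -/

section PartialDerivatives

variable {F H : EuclideanSpace ℝ (Fin n) → ℝ} {u : EuclideanSpace ℝ (Fin n)}

theorem pd_add (i : Fin n) (hF : ContDiffAt ℝ ∞ F u) (hH : ContDiffAt ℝ ∞ H u) :
    pd i (fun v => F v + H v) u = pd i F u + pd i H u := by
  unfold pd
  rw [fderiv_fun_add (hF.differentiableAt (by simp)) (hH.differentiableAt (by simp))]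
  rfl

theorem pd_sub (i : Fin n) (hF : ContDiffAt ℝ ∞ F u) (hH : ContDiffAt ℝ ∞ H u) :
    pd i (fun v => F v - H v) u = pd i F u - pd i H u := by
  unfold pd
  rw [fderiv_fun_sub (hF.differentiableAt (by simp)) (hH.differentiableAt (by simp))]
  rfl

theorem pd_mul (i : Fin n) (hF : ContDiffAt ℝ ∞ F u) (hH : ContDiffAt ℝ ∞ H u) :
    pd i (fun v => F v * H v) u = pd i F u * H u + F u * pd i H u := by
  unfold pd
  rw [fderiv_fun_mul (hF.differentiableAt (by simp)) (hH.differentiableAt (by simp))]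
  simp only [add_apply, smul_apply, smul_eq_mul]
  ring

theorem pd_const (i : Fin n) (c : ℝ) : pd i (fun _ => c) u = 0 := by
  simp [pd]

theorem pd_const_mul (i : Fin n) (c : ℝ) (hF : ContDiffAt ℝ ∞ F u) :
    pd i (fun v => c * F v) u = c * pd i F u := by
  rw [pd_mul i contDiffAt_const hF, pd_const]
  ring

theorem pd_neg (i : Fin n) : pd i (fun v => -F v) u = -pd i F u := by
  simp [pd]

theorem pd_sum (i : Fin n) {ι : Type*} {s : Finset ι} {F : ι → EuclideanSpace ℝ (Fin n) → ℝ}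
    (hF : ∀ k, ContDiffAt ℝ ∞ (F k) u) :
    pd i (fun v => ∑ k ∈ s, F k v) u = ∑ k ∈ s, pd i (F k) u := by
  unfold pd
  rw [fderiv_fun_sum fun k _ => (hF k).differentiableAt (by simp)]
  simp

theorem pd_congr (i : Fin n) {U : Set (EuclideanSpace ℝ (Fin n))} (hU : IsOpen U) (hu : u ∈ U)
    (h : ∀ v ∈ U, F v = H v) : pd i F u = pd i H u := by
  unfold pd
  rw [Filter.EventuallyEq.fderiv_eq]
  filter_upwards [hU.mem_nhds hu] using h

theorem contDiffAt_pd (i : Fin n) (hF : ContDiffAt ℝ ∞ F u) : ContDiffAt ℝ ∞ (pd i F) u := by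
  unfold pd
  exact (hF.fderiv_right (m := ∞) (by simp)).clm_apply contDiffAt_const

theorem pd_comm (i j : Fin n) (hF : ContDiffAt ℝ ∞ F u) :
    pd i (pd j F) u = pd j (pd i F) u := by
  have h (i j : Fin n) : pd i (pd j F) u
      = fderiv ℝ (fderiv ℝ F) u (EuclideanSpace.single i 1) (EuclideanSpace.single j 1) := by
    conv_lhs => unfold pd
    rw [fderiv_clm_apply ((hF.fderiv_right (m := ∞) (by simp)).differentiableAt (by simp))
      (differentiableAt_const _)]
    simp
  rw [h, h]
  exact (hF.isSymmSndFDerivAt (by simpa using WithTop.coe_le_coe.2 (le_top (a := (2 : ℕ∞))))).eq _ _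

end PartialDerivatives

/-! ### Entrywise derivatives of matrices -/

section MatrixDerivatives

/-- The entrywise partial derivative of a matrix-valued function. -/
def pdMatrix (m : Fin n) (A : EuclideanSpace ℝ (Fin n) → Matrix (Fin n) (Fin n) ℝ)
    (u : EuclideanSpace ℝ (Fin n)) : Matrix (Fin n) (Fin n) ℝ :=
  Matrix.of fun i j => pd m (fun v => A v i j) u

/-- A matrix-valued function all of whose entries are smooth at `u`. -/
def SmoothMatrixAt (A : EuclideanSpace ℝ (Fin n) → Matrix (Fin n) (Fin n) ℝ)
    (u : EuclideanSpace ℝ (Fin n)) : Prop :=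
  ∀ i j, ContDiffAt ℝ ∞ (fun v => A v i j) u

variable {A B : EuclideanSpace ℝ (Fin n) → Matrix (Fin n) (Fin n) ℝ}
  {u : EuclideanSpace ℝ (Fin n)}

theorem SmoothMatrixAt.add (hA : SmoothMatrixAt A u) (hB : SmoothMatrixAt B u) :
    SmoothMatrixAt (fun v => A v + B v) u :=
  fun i j => (hA i j).add (hB i j)

theorem SmoothMatrixAt.sub (hA : SmoothMatrixAt A u) (hB : SmoothMatrixAt B u) :
    SmoothMatrixAt (fun v => A v - B v) u :=
  fun i j => (hA i j).sub (hB i j)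

theorem SmoothMatrixAt.mul (hA : SmoothMatrixAt A u) (hB : SmoothMatrixAt B u) :
    SmoothMatrixAt (fun v => A v * B v) u := by
  intro i j
  simp only [Matrix.mul_apply]
  exact ContDiffAt.sum fun k _ => (hA i k).mul (hB k j)

theorem SmoothMatrixAt.transpose (hA : SmoothMatrixAt A u) :
    SmoothMatrixAt (fun v => (A v).transpose) u :=
  fun i j => hA j i

theorem SmoothMatrixAt.pdMatrix (m : Fin n) (hA : SmoothMatrixAt A u) :
    SmoothMatrixAt (pdMatrix m A) u :=
  fun i j => contDiffAt_pd m (hA i j)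

theorem SmoothMatrixAt.det (hA : SmoothMatrixAt A u) :
    ContDiffAt ℝ ∞ (fun v => (A v).det) u := by
  simp only [Matrix.det_apply']
  exact ContDiffAt.sum fun σ _ =>
    contDiffAt_const.mul (contDiffAt_prod fun i _ => hA _ _)

/-- Cramer's rule: an entry of the inverse is 1/det times the determinant of A with one row replaced
by a constant one. -/
theorem SmoothMatrixAt.inv (hA : SmoothMatrixAt A u) (h : (A u).det ≠ 0) :
    SmoothMatrixAt (fun v => (A v)⁻¹) u := by
  intro i j
  simp only [Matrix.inv_def, Ring.inverse_eq_inv', Matrix.smul_apply, smul_eq_mul,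
    Matrix.adjugate_apply]
  refine (hA.det.inv h).mul (SmoothMatrixAt.det fun k l => ?_)
  by_cases hk : k = j
  · subst hk
    simpa using contDiffAt_const
  · simpa [Matrix.updateRow_apply, hk] using hA k l

theorem pdMatrix_add (m : Fin n) (hA : SmoothMatrixAt A u) (hB : SmoothMatrixAt B u) :
    pdMatrix m (fun v => A v + B v) u = pdMatrix m A u + pdMatrix m B u := by
  ext i j
  exact pd_add m (hA i j) (hB i j)

theorem pdMatrix_sub (m : Fin n) (hA : SmoothMatrixAt A u) (hB : SmoothMatrixAt B u) :
    pdMatrix m (fun v => A v - B v) u = pdMatrix m A u - pdMatrix m B u := by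
  ext i j
  exact pd_sub m (hA i j) (hB i j)

theorem pdMatrix_mul (m : Fin n) (hA : SmoothMatrixAt A u) (hB : SmoothMatrixAt B u) :
    pdMatrix m (fun v => A v * B v) u = pdMatrix m A u * B u + A u * pdMatrix m B u := by
  ext i j
  simp only [pdMatrix, Matrix.of_apply, Matrix.add_apply, Matrix.mul_apply]
  rw [pd_sum m fun k => (hA i k).mul (hB k j), ← Finset.sum_add_distrib]
  exact Finset.sum_congr rfl fun k _ => pd_mul m (hA i k) (hB k j)

theorem pdMatrix_transpose (m : Fin n) :
    pdMatrix m (fun v => (A v).transpose) u = (pdMatrix m A u).transpose := rfl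

theorem pdMatrix_congr (m : Fin n) {U : Set (EuclideanSpace ℝ (Fin n))} (hU : IsOpen U)
    (hu : u ∈ U) (h : ∀ v ∈ U, A v = B v) : pdMatrix m A u = pdMatrix m B u := by
  ext i j
  exact pd_congr m hU hu fun v hv => by rw [h v hv]

theorem pdMatrix_comm (k l : Fin n) (hA : SmoothMatrixAt A u) :
    pdMatrix k (pdMatrix l A) u = pdMatrix l (pdMatrix k A) u := by
  ext i j
  exact pd_comm k l (hA i j)

end MatrixDerivatives

end CoordMetric

/-! ### Levi-Civita connection and algebraic symmetries of the curvature. -/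

namespace CoordMetric

variable {n : ℕ}

/-- `G` is a smooth field of nondegenerate symmetric matrices on the open set `U`. -/
structure IsSmoothMetricOn (G : EuclideanSpace ℝ (Fin n) → Matrix (Fin n) (Fin n) ℝ)
    (U : Set (EuclideanSpace ℝ (Fin n))) : Prop where
  isOpen : IsOpen U
  smooth : ∀ u ∈ U, SmoothMatrixAt G u
  symm : ∀ u ∈ U, ∀ i j, G u i j = G u j i
  det_ne_zero : ∀ u ∈ U, (G u).det ≠ 0

/-- The connection matrix `Γ_m`, with entries `Γ^a_mi`. -/
def connMatrix (G : EuclideanSpace ℝ (Fin n) → Matrix (Fin n) (Fin n) ℝ) (m : Fin n)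
    (u : EuclideanSpace ℝ (Fin n)) : Matrix (Fin n) (Fin n) ℝ :=
  Matrix.of fun a i => christoffel G a m i u

/-- The curvature matrix `R_kl`, with entries `R_klj^p`. -/
def curvMatrix (G : EuclideanSpace ℝ (Fin n) → Matrix (Fin n) (Fin n) ℝ) (k l : Fin n)
    (u : EuclideanSpace ℝ (Fin n)) : Matrix (Fin n) (Fin n) ℝ :=
  Matrix.of fun p j => riemannUp G k l j p u

variable {G : EuclideanSpace ℝ (Fin n) → Matrix (Fin n) (Fin n) ℝ}
  {U : Set (EuclideanSpace ℝ (Fin n))} {u : EuclideanSpace ℝ (Fin n)}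

namespace IsSmoothMetricOn

theorem sum_inv_mul (hG : IsSmoothMetricOn G U) (hu : u ∈ U) (i j : Fin n) :
    ∑ k, (G u)⁻¹ i k * G u k j = if i = j then 1 else 0 := by
  have h := Matrix.nonsing_inv_mul (G u) (isUnit_iff_ne_zero.2 (hG.det_ne_zero u hu))
  have := congrFun (congrFun h i) j
  rwa [Matrix.mul_apply, Matrix.one_apply] at this

theorem sum_mul_inv (hG : IsSmoothMetricOn G U) (hu : u ∈ U) (i j : Fin n) :
    ∑ k, G u i k * (G u)⁻¹ k j = if i = j then 1 else 0 := by
  have h := Matrix.mul_nonsing_inv (G u) (isUnit_iff_ne_zero.2 (hG.det_ne_zero u hu))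
  have := congrFun (congrFun h i) j
  rwa [Matrix.mul_apply, Matrix.one_apply] at this

theorem transpose_eq (hG : IsSmoothMetricOn G U) (hu : u ∈ U) : (G u).transpose = G u := by
  ext i j
  exact hG.symm u hu j i

theorem inv_symm (hG : IsSmoothMetricOn G U) (hu : u ∈ U) (i j : Fin n) :
    (G u)⁻¹ i j = (G u)⁻¹ j i := by
  conv_rhs => rw [← hG.transpose_eq hu, ← Matrix.transpose_nonsing_inv]
  rfl

theorem contDiffAt_christoffel (hG : IsSmoothMetricOn G U) (hu : u ∈ U) (k i j : Fin n) :
    ContDiffAt ℝ ∞ (christoffel G k i j) u := by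
  unfold christoffel
  have h := hG.smooth u hu
  exact contDiffAt_const.mul (ContDiffAt.sum fun l _ =>
    (h.inv (hG.det_ne_zero u hu) k l).mul
      (((contDiffAt_pd _ (h _ _)).add (contDiffAt_pd _ (h _ _))).sub (contDiffAt_pd _ (h _ _))))

theorem smoothMatrixAt_connMatrix (hG : IsSmoothMetricOn G U) (hu : u ∈ U) (m : Fin n) :
    SmoothMatrixAt (connMatrix G m) u :=
  fun k j => hG.contDiffAt_christoffel hu k m j

theorem christoffel_symm (hG : IsSmoothMetricOn G U) (hu : u ∈ U) (k i j : Fin n) :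
    christoffel G k i j u = christoffel G k j i u := by
  unfold christoffel
  congr 1
  refine Finset.sum_congr rfl fun l _ => ?_
  rw [pd_congr l hG.isOpen hu fun v hv => hG.symm v hv i j]
  ring

/-- Lowering the index cancels G⁻¹ and leaves the Christoffel symbols of the first kind. -/
theorem sum_metric_mul_christoffel (hG : IsSmoothMetricOn G U) (hu : u ∈ U) (b i j : Fin n) :
    ∑ a, G u b a * christoffel G a i j u
      = 1 / 2 * (pd i (fun v => G v j b) u + pd j (fun v => G v i b) u
          - pd b (fun v => G v i j) u) := by
  unfold christoffel
  calc _ = 1 / 2 * ∑ l, (∑ a, G u b a * (G u)⁻¹ a l) * (pd i (fun v => G v j l) u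
          + pd j (fun v => G v i l) u - pd l (fun v => G v i j) u) := by
        simp only [Finset.mul_sum, Finset.sum_mul]
        rw [Finset.sum_comm]
        exact Finset.sum_congr rfl fun l _ => Finset.sum_congr rfl fun a _ => by ring
    _ = _ := by simp [hG.sum_mul_inv hu]

/-- Metric compatibility, Dg = 0: when two symbols of the first kind are added, all but one
derivative of g cancel. -/
theorem pdMatrix_metric (hG : IsSmoothMetricOn G U) (hu : u ∈ U) (m : Fin n) :
    pdMatrix m G u = (connMatrix G m u).transpose * G u + G u * connMatrix G m u := by
  ext i j
  have h1 := hG.sum_metric_mul_christoffel hu i m j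
  have h2 := hG.sum_metric_mul_christoffel hu j m i
  simp only [Matrix.add_apply, Matrix.mul_apply, Matrix.transpose_apply, connMatrix,
    Matrix.of_apply, pdMatrix, h1]
  have h3 : ∑ a, christoffel G a m i u * G u a j = ∑ a, G u j a * christoffel G a m i u :=
    Finset.sum_congr rfl fun a _ => by rw [hG.symm u hu a j]; ring
  rw [h3, h2, pd_congr m hG.isOpen hu fun v hv => hG.symm v hv j i]
  ring

end IsSmoothMetricOn

/-- The structure equation: up to the sign convention the curvature is dΓ + Γ∧Γ. In matrix form,
index-heavy identities reduce to noncommutative ring identities. -/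
theorem curvMatrix_eq (G : EuclideanSpace ℝ (Fin n) → Matrix (Fin n) (Fin n) ℝ) (k l : Fin n)
    (u : EuclideanSpace ℝ (Fin n)) :
    curvMatrix G k l u = pdMatrix l (connMatrix G k) u - pdMatrix k (connMatrix G l) u
      + (connMatrix G l u * connMatrix G k u - connMatrix G k u * connMatrix G l u) := by
  ext p j
  simp only [curvMatrix, riemannUp, Matrix.of_apply, Matrix.add_apply, Matrix.sub_apply,
    pdMatrix, connMatrix, Matrix.mul_apply, Finset.sum_sub_distrib]
  congr 2
  · exact Finset.sum_congr rfl fun a _ => by ring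
  · exact Finset.sum_congr rfl fun a _ => by ring

theorem curvMatrix_antisymm (k l : Fin n) : curvMatrix G k l u = -curvMatrix G l k u := by
  rw [curvMatrix_eq, curvMatrix_eq]
  abel

theorem riemannUp_antisymm (k l j p : Fin n) :
    riemannUp G k l j p u = -riemannUp G l k j p u :=
  congrFun (congrFun (curvMatrix_antisymm (G := G) (u := u) k l) p) j

theorem riemann_antisymm_left (k l j p : Fin n) :
    riemann G k l j p u = -riemann G l k j p u := by
  unfold riemann
  rw [← Finset.sum_neg_distrib]
  exact Finset.sum_congr rfl fun m _ => by rw [riemannUp_antisymm k l]; ring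

theorem riemann_eq_transpose_mul (k l j i : Fin n) :
    riemann G k l j i u = ((curvMatrix G k l u).transpose * G u) j i := rfl

namespace IsSmoothMetricOn

theorem smoothMatrixAt_curvMatrix (hG : IsSmoothMetricOn G U) (hu : u ∈ U) (k l : Fin n) :
    SmoothMatrixAt (curvMatrix G k l) u := by
  have h := hG.smoothMatrixAt_connMatrix hu
  rw [funext (curvMatrix_eq G k l)]
  exact (((h k).pdMatrix l).sub ((h l).pdMatrix k)).add (((h l).mul (h k)).sub ((h k).mul (h l)))

theorem contDiffAt_riemannUp (hG : IsSmoothMetricOn G U) (hu : u ∈ U) (k l j p : Fin n) :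
    ContDiffAt ℝ ∞ (riemannUp G k l j p) u :=
  hG.smoothMatrixAt_curvMatrix hu k l p j

theorem contDiffAt_riemann (hG : IsSmoothMetricOn G U) (hu : u ∈ U) (k l j i : Fin n) :
    ContDiffAt ℝ ∞ (riemann G k l j i) u :=
  (hG.smoothMatrixAt_curvMatrix hu k l).transpose.mul (hG.smooth u hu) j i

theorem contDiffAt_ricci (hG : IsSmoothMetricOn G U) (hu : u ∈ U) (i k : Fin n) :
    ContDiffAt ℝ ∞ (ricci G i k) u := by
  unfold ricci
  exact ContDiffAt.sum fun j _ => hG.contDiffAt_riemannUp hu i j k j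

theorem contDiffAt_scalar (hG : IsSmoothMetricOn G U) (hu : u ∈ U) :
    ContDiffAt ℝ ∞ (scalar G) u := by
  unfold scalar
  exact ContDiffAt.sum fun i _ => ContDiffAt.sum fun k _ =>
    ((hG.smooth u hu).inv (hG.det_ne_zero u hu) i k).mul (hG.contDiffAt_ricci hu i k)

/-- The first Bianchi identity. -/
theorem riemannUp_cyclic (hG : IsSmoothMetricOn G U) (hu : u ∈ U) (i j k p : Fin n) :
    riemannUp G i j k p u + riemannUp G j k i p u + riemannUp G k i j p u = 0 := by
  have hs (a b c d : Fin n) : pd a (christoffel G b c d) u = pd a (christoffel G b d c) u :=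
    pd_congr a hG.isOpen hu fun v hv => hG.christoffel_symm hv b c d
  unfold riemannUp
  rw [hs i p k j, hs j p k i, hs k p j i]
  have h : (∑ m, (christoffel G m i k u * christoffel G p j m u
        - christoffel G m j k u * christoffel G p i m u))
      + (∑ m, (christoffel G m j i u * christoffel G p k m u
        - christoffel G m k i u * christoffel G p j m u))
      + (∑ m, (christoffel G m k j u * christoffel G p i m u
        - christoffel G m i j u * christoffel G p k m u)) = 0 := by
    rw [← Finset.sum_add_distrib, ← Finset.sum_add_distrib]
    refine Finset.sum_eq_zero fun m _ => ?_
    rw [hG.christoffel_symm hu m k i, hG.christoffel_symm hu m k j, hG.christoffel_symm hu m j i]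
    ring
  linarith

theorem riemann_cyclic (hG : IsSmoothMetricOn G U) (hu : u ∈ U) (i j k l : Fin n) :
    riemann G i j k l u + riemann G j k i l u + riemann G k i j l u = 0 := by
  unfold riemann
  rw [← Finset.sum_add_distrib, ← Finset.sum_add_distrib]
  refine Finset.sum_eq_zero fun m _ => ?_
  rw [← add_mul, ← add_mul, hG.riemannUp_cyclic hu, zero_mul]

/-- Curvature is skew-adjoint because second partial derivatives of G commute: substituting Dg = 0
twice, the commutator of ∂_k and ∂_l on G is exactly this expression. -/
theorem transpose_curvMatrix_mul_metric (hG : IsSmoothMetricOn G U) (hu : u ∈ U) (k l : Fin n) :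
    (curvMatrix G k l u).transpose * G u + G u * curvMatrix G k l u = 0 := by
  have hΓ := hG.smoothMatrixAt_connMatrix hu
  have hs := hG.smooth u hu
  have key (k l : Fin n) : pdMatrix l (pdMatrix k G) u
      = (pdMatrix l (connMatrix G k) u).transpose * G u
        + (connMatrix G k u).transpose * ((connMatrix G l u).transpose * G u
          + G u * connMatrix G l u)
        + (((connMatrix G l u).transpose * G u + G u * connMatrix G l u) * connMatrix G k u
          + G u * pdMatrix l (connMatrix G k) u) := by
    rw [pdMatrix_congr l hG.isOpen hu fun v hv => hG.pdMatrix_metric hv k,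
      pdMatrix_add l ((hΓ k).transpose.mul hs) (hs.mul (hΓ k)),
      pdMatrix_mul l (hΓ k).transpose hs, pdMatrix_mul l hs (hΓ k), hG.pdMatrix_metric hu l,
      pdMatrix_transpose]
  have h := pdMatrix_comm l k hs
  rw [key, key, ← sub_eq_zero] at h
  rw [curvMatrix_eq, ← h]
  simp only [Matrix.transpose_add, Matrix.transpose_sub, Matrix.transpose_mul]
  noncomm_ring

theorem riemann_antisymm_right (hG : IsSmoothMetricOn G U) (hu : u ∈ U) (k l j i : Fin n) :
    riemann G k l j i u = -riemann G k l i j u := by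
  have h := congrFun (congrFun (hG.transpose_curvMatrix_mul_metric hu k l) j) i
  rw [Matrix.add_apply, ← riemann_eq_transpose_mul] at h
  have h2 : (G u * curvMatrix G k l u) j i = riemann G k l i j u := by
    rw [riemann_eq_transpose_mul, Matrix.mul_apply, Matrix.mul_apply]
    exact Finset.sum_congr rfl fun a _ => by rw [hG.symm u hu, mul_comm]; rfl
  rw [h2, Matrix.zero_apply] at h
  linarith

theorem riemann_pair_symm (hG : IsSmoothMetricOn G U) (hu : u ∈ U) (i j k l : Fin n) :
    riemann G i j k l u = riemann G k l i j u := by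
  have c1 := hG.riemann_cyclic hu i j k l
  have c2 := hG.riemann_cyclic hu j k l i
  have c3 := hG.riemann_cyclic hu k l i j
  have c4 := hG.riemann_cyclic hu l i j k
  have a := hG.riemann_antisymm_right hu
  have b (i j k l : Fin n) := riemann_antisymm_left (G := G) (u := u) i j k l
  -- The octahedron argument: four cyclic identities, combined through the two skew symmetries.
  linarith [a i j k l, a i j l k, a j k i l, a j k l i, a k i j l, a l j k i, a k l i j,
    a l i j k, a l i k j, a j l k i, b l j k i, b k i j l, b i k l j, a i k l j]

end IsSmoothMetricOn

end CoordMetric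

/-! ### Covariant derivatives, the second Bianchi identity and its contractions. -/

namespace CoordMetric

variable {n : ℕ}

variable (G : EuclideanSpace ℝ (Fin n) → Matrix (Fin n) (Fin n) ℝ)

/-- The covariant derivative of a `(0, 2)`-tensor field. -/
def cov₂ (T : Fin n → Fin n → EuclideanSpace ℝ (Fin n) → ℝ) (m i j : Fin n)
    (u : EuclideanSpace ℝ (Fin n)) : ℝ :=
  pd m (T i j) u - ∑ a, (christoffel G a m i u * T a j u + christoffel G a m j u * T i a u)

/-- The covariant derivative of a `(0, 4)`-tensor field. -/
def cov₄ (T : Fin n → Fin n → Fin n → Fin n → EuclideanSpace ℝ (Fin n) → ℝ) (m i j k l : Fin n)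
    (u : EuclideanSpace ℝ (Fin n)) : ℝ :=
  pd m (T i j k l) u
    - ∑ a, (christoffel G a m i u * T a j k l u + christoffel G a m j u * T i a k l u
        + christoffel G a m k u * T i j a l u + christoffel G a m l u * T i j k a u)

/-- The covariant derivative `∇_m R_klj^p` of the curvature. -/
def covRiemannUp (m k l j p : Fin n) (u : EuclideanSpace ℝ (Fin n)) : ℝ :=
  pd m (riemannUp G k l j p) u
    + ∑ a, (christoffel G p m a u * riemannUp G k l j a u
        - riemannUp G k l a p u * christoffel G a m j u)
    - ∑ a, (christoffel G a m k u * riemannUp G a l j p u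
        + christoffel G a m l u * riemannUp G k a j p u)

variable {G} {U : Set (EuclideanSpace ℝ (Fin n))} {u : EuclideanSpace ℝ (Fin n)}

theorem covRiemannUp_antisymm (m k l j p : Fin n) :
    covRiemannUp G m k l j p u = -covRiemannUp G m l k j p u := by
  unfold covRiemannUp
  have h : riemannUp G k l j p = fun v => -riemannUp G l k j p v :=
    funext fun v => riemannUp_antisymm k l j p
  rw [h, pd_neg]
  simp only [riemannUp_antisymm k l, riemannUp_antisymm _ l, riemannUp_antisymm k _]
  simp only [Finset.sum_add_distrib, Finset.sum_sub_distrib, mul_neg, neg_mul,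
    Finset.sum_neg_distrib]
  ring

namespace IsSmoothMetricOn

/-- The second Bianchi identity. The cyclic sum of ∂_m R_kl + [Γ_m, R_kl] vanishes by the structure
equation and commuting partials; the connection terms on the form indices cancel separately because
the connection is torsion-free. -/
theorem covRiemannUp_cyclic (hG : IsSmoothMetricOn G U) (hu : u ∈ U) (m k l j p : Fin n) :
    covRiemannUp G m k l j p u + covRiemannUp G k l m j p u + covRiemannUp G l m k j p u = 0 := by
  have hΓ := hG.smoothMatrixAt_connMatrix hu
  have hd (m k l : Fin n) : pdMatrix m (curvMatrix G k l) u
      = pdMatrix m (pdMatrix l (connMatrix G k)) u - pdMatrix m (pdMatrix k (connMatrix G l)) u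
        + ((pdMatrix m (connMatrix G l) u * connMatrix G k u
            + connMatrix G l u * pdMatrix m (connMatrix G k) u)
          - (pdMatrix m (connMatrix G k) u * connMatrix G l u
            + connMatrix G k u * pdMatrix m (connMatrix G l) u)) := by
    rw [funext (curvMatrix_eq G k l),
      pdMatrix_add m (((hΓ k).pdMatrix l).sub ((hΓ l).pdMatrix k))
        (((hΓ l).mul (hΓ k)).sub ((hΓ k).mul (hΓ l))),
      pdMatrix_sub m ((hΓ k).pdMatrix l) ((hΓ l).pdMatrix k),
      pdMatrix_sub m ((hΓ l).mul (hΓ k)) ((hΓ k).mul (hΓ l)),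
      pdMatrix_mul m (hΓ l) (hΓ k), pdMatrix_mul m (hΓ k) (hΓ l)]
  have hmat : (pdMatrix m (curvMatrix G k l) u
        + (connMatrix G m u * curvMatrix G k l u - curvMatrix G k l u * connMatrix G m u))
      + (pdMatrix k (curvMatrix G l m) u
        + (connMatrix G k u * curvMatrix G l m u - curvMatrix G l m u * connMatrix G k u))
      + (pdMatrix l (curvMatrix G m k) u
        + (connMatrix G l u * curvMatrix G m k u - curvMatrix G m k u * connMatrix G l u)) = 0 := by
    rw [hd, hd, hd, pdMatrix_comm m l (hΓ k), pdMatrix_comm m k (hΓ l), pdMatrix_comm l k (hΓ m)]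
    simp only [curvMatrix_eq]
    noncomm_ring
  have h := congrFun (congrFun hmat p) j
  simp only [Matrix.add_apply, Matrix.sub_apply, Matrix.mul_apply, Matrix.zero_apply, pdMatrix,
    curvMatrix, connMatrix, Matrix.of_apply, ← Finset.sum_sub_distrib] at h
  have h0 : (∑ a, (christoffel G a m k u * riemannUp G a l j p u
        + christoffel G a m l u * riemannUp G k a j p u))
      + (∑ a, (christoffel G a k l u * riemannUp G a m j p u
        + christoffel G a k m u * riemannUp G l a j p u))
      + (∑ a, (christoffel G a l m u * riemannUp G a k j p u
        + christoffel G a l k u * riemannUp G m a j p u)) = 0 := by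
    rw [← Finset.sum_add_distrib, ← Finset.sum_add_distrib]
    refine Finset.sum_eq_zero fun a _ => ?_
    rw [hG.christoffel_symm hu a k m, hG.christoffel_symm hu a l m, hG.christoffel_symm hu a l k,
      riemannUp_antisymm k a, riemannUp_antisymm l a, riemannUp_antisymm m a]
    ring
  unfold covRiemannUp
  linarith

theorem pd_metric (hG : IsSmoothMetricOn G U) (hu : u ∈ U) (m i j : Fin n) :
    pd m (fun v => G v i j) u
      = ∑ a, (christoffel G a m i u * G u a j + G u i a * christoffel G a m j u) := by
  rw [Finset.sum_add_distrib]
  exact congrFun (congrFun (hG.pdMatrix_metric hu m) i) j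

/-- Lowering an index commutes with covariant differentiation. -/
theorem cov₄_riemann (hG : IsSmoothMetricOn G U) (hu : u ∈ U) (m k l j i : Fin n) :
    cov₄ G (riemann G) m k l j i u = ∑ p, covRiemannUp G m k l j p u * G u p i := by
  have hR := hG.contDiffAt_riemannUp hu
  have hs := hG.smooth u hu
  have h1 : pd m (riemann G k l j i) u = ∑ p, (pd m (riemannUp G k l j p) u * G u p i
      + riemannUp G k l j p u
        * ∑ a, (christoffel G a m p u * G u a i + G u p a * christoffel G a m i u)) := by
    unfold riemann
    rw [pd_sum m fun p => (hR k l j p).mul (hs p i)]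
    exact Finset.sum_congr rfl fun p _ => by
      rw [pd_mul m (hR k l j p) (hs p i), hG.pd_metric hu]
  unfold cov₄ covRiemannUp
  rw [h1]
  unfold riemann
  simp only [Finset.mul_sum, Finset.sum_mul, Finset.sum_add_distrib, Finset.sum_sub_distrib,
    add_mul, sub_mul, mul_add]
  have c1 : ∑ p, ∑ a, riemannUp G k l j p u * (christoffel G a m p u * G u a i)
      = ∑ p, ∑ a, christoffel G p m a u * riemannUp G k l j a u * G u p i := by
    rw [Finset.sum_comm]
    exact Finset.sum_congr rfl fun p _ => Finset.sum_congr rfl fun a _ => by ring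
  have c2 : ∑ p, ∑ a, riemannUp G k l j p u * (G u p a * christoffel G a m i u)
      = ∑ a, ∑ p, christoffel G a m i u * (riemannUp G k l j p u * G u p a) := by
    rw [Finset.sum_comm]
    exact Finset.sum_congr rfl fun p _ => Finset.sum_congr rfl fun a _ => by ring
  have c3 : ∑ a, ∑ p, christoffel G a m j u * (riemannUp G k l a p u * G u p i)
      = ∑ p, ∑ a, riemannUp G k l a p u * christoffel G a m j u * G u p i := by
    rw [Finset.sum_comm]
    exact Finset.sum_congr rfl fun p _ => Finset.sum_congr rfl fun a _ => by ring
  have c4 : ∑ a, ∑ p, christoffel G a m k u * (riemannUp G a l j p u * G u p i)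
      = ∑ p, ∑ a, christoffel G a m k u * riemannUp G a l j p u * G u p i := by
    rw [Finset.sum_comm]
    exact Finset.sum_congr rfl fun p _ => Finset.sum_congr rfl fun a _ => by ring
  have c5 : ∑ a, ∑ p, christoffel G a m l u * (riemannUp G k a j p u * G u p i)
      = ∑ p, ∑ a, christoffel G a m l u * riemannUp G k a j p u * G u p i := by
    rw [Finset.sum_comm]
    exact Finset.sum_congr rfl fun p _ => Finset.sum_congr rfl fun a _ => by ring
  rw [c1, c2, c3, c4, c5]
  ring

/-- Contracting an upper with a lower index commutes with D: the two connection terms on the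
contracted index cancel, without any use of Dg = 0. -/
theorem cov₂_ricci (hG : IsSmoothMetricOn G U) (hu : u ∈ U) (m i k : Fin n) :
    cov₂ G (ricci G) m i k u = ∑ p, covRiemannUp G m i p k p u := by
  have hR := hG.contDiffAt_riemannUp hu
  unfold cov₂ covRiemannUp ricci
  rw [pd_sum m fun p => hR i p k p]
  simp only [Finset.mul_sum, Finset.sum_add_distrib, Finset.sum_sub_distrib]
  have c1 : ∑ a, ∑ p, christoffel G a m i u * riemannUp G a p k p u
      = ∑ p, ∑ a, christoffel G a m i u * riemannUp G a p k p u := Finset.sum_comm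
  have c2 : ∑ a, ∑ p, christoffel G a m k u * riemannUp G i p a p u
      = ∑ p, ∑ a, riemannUp G i p a p u * christoffel G a m k u := by
    rw [Finset.sum_comm]
    exact Finset.sum_congr rfl fun p _ => Finset.sum_congr rfl fun a _ => by ring
  have c3 : ∑ p, ∑ a, christoffel G a m p u * riemannUp G i a k p u
      = ∑ p, ∑ a, christoffel G p m a u * riemannUp G i p k a u := Finset.sum_comm
  rw [c1, c2, c3]
  ring

/-- Contracting an index that was lowered with the metric. -/
theorem sum_inv_mul_lower (hG : IsSmoothMetricOn G U) (hu : u ∈ U) (F : Fin n → Fin n → ℝ) :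
    ∑ j, ∑ l, (G u)⁻¹ j l * ∑ p, F j p * G u p l = ∑ j, F j j := by
  refine Finset.sum_congr rfl fun j _ => ?_
  calc _ = ∑ p, F j p * ∑ l, G u p l * (G u)⁻¹ l j := by
        simp only [Finset.mul_sum]
        rw [Finset.sum_comm]
        refine Finset.sum_congr rfl fun p _ => Finset.sum_congr rfl fun l _ => ?_
        rw [hG.inv_symm hu j l]
        ring
    _ = F j j := by simp [hG.sum_mul_inv hu]

theorem sum_inv_mul_riemann (hG : IsSmoothMetricOn G U) (hu : u ∈ U) (i k : Fin n) :
    ∑ j, ∑ l, (G u)⁻¹ j l * riemann G i j k l u = ricci G i k u :=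
  hG.sum_inv_mul_lower hu fun j p => riemannUp G i j k p u

theorem ricci_symm (hG : IsSmoothMetricOn G U) (hu : u ∈ U) (i k : Fin n) :
    ricci G i k u = ricci G k i u := by
  rw [← hG.sum_inv_mul_riemann hu, ← hG.sum_inv_mul_riemann hu, Finset.sum_comm]
  refine Finset.sum_congr rfl fun j _ => Finset.sum_congr rfl fun l _ => ?_
  rw [hG.inv_symm hu l j, hG.riemann_pair_symm hu i l k j]

theorem cov₂_symm (hG : IsSmoothMetricOn G U) (hu : u ∈ U)
    {T : Fin n → Fin n → EuclideanSpace ℝ (Fin n) → ℝ} (hT : ∀ v ∈ U, ∀ i j, T i j v = T j i v)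
    (m i j : Fin n) : cov₂ G T m i j u = cov₂ G T m j i u := by
  unfold cov₂
  rw [pd_congr m hG.isOpen hu fun v hv => hT v hv i j]
  congr 1
  refine Finset.sum_congr rfl fun a _ => ?_
  rw [hT u hu a j, hT u hu i a]
  ring

theorem cov₄_riemann_pair_symm (hG : IsSmoothMetricOn G U) (hu : u ∈ U) (m i j k l : Fin n) :
    cov₄ G (riemann G) m i j k l u = cov₄ G (riemann G) m k l i j u := by
  unfold cov₄
  rw [pd_congr m hG.isOpen hu fun v hv => hG.riemann_pair_symm hv i j k l]
  congr 1
  refine Finset.sum_congr rfl fun a _ => ?_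
  rw [hG.riemann_pair_symm hu a j, hG.riemann_pair_symm hu i a, hG.riemann_pair_symm hu i j a,
    hG.riemann_pair_symm hu i j k a]
  ring

theorem cov₄_riemann_antisymm_right (hG : IsSmoothMetricOn G U) (hu : u ∈ U)
    (m i j k l : Fin n) :
    cov₄ G (riemann G) m i j k l u = -cov₄ G (riemann G) m i j l k u := by
  unfold cov₄
  rw [pd_congr m hG.isOpen hu fun v hv => hG.riemann_antisymm_right hv i j k l, pd_neg, neg_sub',
    sub_neg_eq_add, sub_eq_add_neg, ← Finset.sum_neg_distrib]
  congr 1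
  refine Finset.sum_congr rfl fun a _ => ?_
  rw [hG.riemann_antisymm_right hu a j, hG.riemann_antisymm_right hu i a,
    hG.riemann_antisymm_right hu i j a, hG.riemann_antisymm_right hu i j k a]
  ring

/-- The divergence of the curvature tensor is the exterior derivative of the Ricci tensor. -/
theorem div_riemann (hG : IsSmoothMetricOn G U) (hu : u ∈ U) (j k l : Fin n) :
    ∑ m, ∑ i, (G u)⁻¹ m i * cov₄ G (riemann G) m i j k l u
      = cov₂ G (ricci G) k l j u - cov₂ G (ricci G) l k j u := by
  -- Move the index to be contracted into the last slot, the lowered one, so that tracing with G⁻¹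
  -- undoes the lowering.
  have h1 (m i : Fin n) : cov₄ G (riemann G) m i j k l u
      = ∑ p, (-covRiemannUp G m k l j p u) * G u p i := by
    rw [hG.cov₄_riemann_pair_symm hu, hG.cov₄_riemann_antisymm_right hu, hG.cov₄_riemann hu,
      ← Finset.sum_neg_distrib]
    exact Finset.sum_congr rfl fun p _ => by ring
  simp only [h1]
  rw [hG.sum_inv_mul_lower hu fun m p => -covRiemannUp G m k l j p u, hG.cov₂_ricci hu,
    hG.cov₂_ricci hu, ← Finset.sum_sub_distrib]
  refine Finset.sum_congr rfl fun m _ => ?_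
  have h2 := hG.covRiemannUp_cyclic hu m k l j m
  have h3 := covRiemannUp_antisymm (G := G) (u := u) l m k j m
  linarith

/-- D(g⁻¹) = 0: differentiate G⁻¹G = 1 and multiply by G⁻¹ on the right. -/
theorem pdMatrix_inv (hG : IsSmoothMetricOn G U) (hu : u ∈ U) (m : Fin n) :
    pdMatrix m (fun v => (G v)⁻¹) u
      = -(connMatrix G m u * (G u)⁻¹ + (G u)⁻¹ * (connMatrix G m u).transpose) := by
  have hs := hG.smooth u hu
  have hunit := isUnit_iff_ne_zero.2 (hG.det_ne_zero u hu)
  have h1 : pdMatrix m (fun v => (G v)⁻¹ * G v) u = 0 := by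
    rw [pdMatrix_congr m (B := fun _ => 1) hG.isOpen hu fun v hv =>
      Matrix.nonsing_inv_mul (G v) (isUnit_iff_ne_zero.2 (hG.det_ne_zero v hv))]
    ext i j
    exact pd_const m _
  rw [pdMatrix_mul m (hs.inv (hG.det_ne_zero u hu)) hs, hG.pdMatrix_metric hu] at h1
  have h2 := congrArg (fun A => A * (G u)⁻¹) h1
  have h3 := Matrix.mul_nonsing_inv (G u) hunit
  have h4 := Matrix.nonsing_inv_mul (G u) hunit
  simp only [add_mul, mul_add, zero_mul, Matrix.mul_assoc, h3, Matrix.mul_one] at h2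
  rw [← Matrix.mul_assoc (G u)⁻¹ (G u), h4, Matrix.one_mul] at h2
  rw [eq_neg_iff_add_eq_zero, add_comm (connMatrix G m u * _)]
  exact h2

theorem pd_inv (hG : IsSmoothMetricOn G U) (hu : u ∈ U) (m i j : Fin n) :
    pd m (fun v => (G v)⁻¹ i j) u
      = -∑ a, (christoffel G i m a u * (G u)⁻¹ a j + (G u)⁻¹ i a * christoffel G j m a u) := by
  rw [Finset.sum_add_distrib]
  exact congrFun (congrFun (hG.pdMatrix_inv hu m) i) j

/-- Metric traces commute with covariant differentiation. -/
theorem pd_trace (hG : IsSmoothMetricOn G U) (hu : u ∈ U)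
    {T : Fin n → Fin n → EuclideanSpace ℝ (Fin n) → ℝ} (hT : ∀ i j, ContDiffAt ℝ ∞ (T i j) u)
    (m : Fin n) :
    pd m (fun v => ∑ i, ∑ j, (G v)⁻¹ i j * T i j v) u
      = ∑ i, ∑ j, (G u)⁻¹ i j * cov₂ G T m i j u := by
  have hi := (hG.smooth u hu).inv (hG.det_ne_zero u hu)
  rw [pd_sum m fun i => ContDiffAt.sum fun j _ => (hi i j).mul (hT i j)]
  have h1 (i : Fin n) : pd m (fun v => ∑ j, (G v)⁻¹ i j * T i j v) u
      = ∑ j, (pd m (fun v => (G v)⁻¹ i j) u * T i j u + (G u)⁻¹ i j * pd m (T i j) u) := by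
    rw [pd_sum m fun j => (hi i j).mul (hT i j)]
    exact Finset.sum_congr rfl fun j _ => pd_mul m (hi i j) (hT i j)
  simp only [h1, hG.pd_inv hu, cov₂, Finset.mul_sum, Finset.sum_mul, mul_sub, mul_add, neg_mul,
    add_mul, Finset.sum_add_distrib, Finset.sum_sub_distrib, neg_add, Finset.sum_neg_distrib]
  have c1 : ∑ i, ∑ j, ∑ a, christoffel G i m a u * (G u)⁻¹ a j * T i j u
      = ∑ i, ∑ j, ∑ a, (G u)⁻¹ i j * (christoffel G a m i u * T a j u) := by
    calc _ = ∑ j, ∑ i, ∑ a, christoffel G i m a u * (G u)⁻¹ a j * T i j u := Finset.sum_comm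
      _ = ∑ j, ∑ a, ∑ i, christoffel G i m a u * (G u)⁻¹ a j * T i j u :=
          Finset.sum_congr rfl fun j _ => Finset.sum_comm
      _ = ∑ a, ∑ j, ∑ i, christoffel G i m a u * (G u)⁻¹ a j * T i j u := Finset.sum_comm
      _ = _ := Finset.sum_congr rfl fun i _ => Finset.sum_congr rfl fun j _ =>
          Finset.sum_congr rfl fun a _ => by ring
  have c2 : ∑ i, ∑ j, ∑ a, (G u)⁻¹ i a * christoffel G j m a u * T i j u
      = ∑ i, ∑ j, ∑ a, (G u)⁻¹ i j * (christoffel G a m j u * T i a u) := by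
    refine Finset.sum_congr rfl fun i _ => ?_
    rw [Finset.sum_comm]
    exact Finset.sum_congr rfl fun j _ => Finset.sum_congr rfl fun a _ => by ring
  rw [c1, c2]
  ring

theorem pd_scalar (hG : IsSmoothMetricOn G U) (hu : u ∈ U) (m : Fin n) :
    pd m (scalar G) u = ∑ i, ∑ j, (G u)⁻¹ i j * cov₂ G (ricci G) m i j u :=
  hG.pd_trace hu (hG.contDiffAt_ricci hu) m

/-- The contracted second Bianchi identity. -/
theorem div_ricci (hG : IsSmoothMetricOn G U) (hu : u ∈ U) (k : Fin n) :
    ∑ m, ∑ i, (G u)⁻¹ m i * cov₂ G (ricci G) m i k u = 1 / 2 * pd k (scalar G) u := by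
  -- Trace `div_riemann` over j and l. Exchanging the traces makes its left side the divergence of
  -- the Ricci tensor; its right side is ds minus that same divergence.
  have h1 : ∑ j, ∑ l, (G u)⁻¹ j l * ∑ m, ∑ i, (G u)⁻¹ m i * cov₄ G (riemann G) m i j k l u
      = ∑ m, ∑ i, (G u)⁻¹ m i * cov₂ G (ricci G) m i k u := by
    have h2 (m i : Fin n) : cov₂ G (ricci G) m i k u
        = ∑ j, ∑ l, (G u)⁻¹ j l * cov₄ G (riemann G) m i j k l u := by
      simp only [hG.cov₄_riemann hu]
      rw [hG.sum_inv_mul_lower hu fun j p => covRiemannUp G m i j k p u, hG.cov₂_ricci hu]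
    simp only [h2, Finset.mul_sum]
    calc _ = ∑ j, ∑ m, ∑ l, ∑ i, (G u)⁻¹ j l
            * ((G u)⁻¹ m i * cov₄ G (riemann G) m i j k l u) :=
          Finset.sum_congr rfl fun j _ => Finset.sum_comm
      _ = ∑ m, ∑ j, ∑ i, ∑ l, (G u)⁻¹ j l
            * ((G u)⁻¹ m i * cov₄ G (riemann G) m i j k l u) := by
          rw [Finset.sum_comm]
          exact Finset.sum_congr rfl fun m _ => Finset.sum_congr rfl fun j _ => Finset.sum_comm
      _ = _ := by
          refine Finset.sum_congr rfl fun m _ => ?_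
          rw [Finset.sum_comm]
          exact Finset.sum_congr rfl fun i _ => Finset.sum_congr rfl fun j _ =>
            Finset.sum_congr rfl fun l _ => by ring
  simp only [hG.div_riemann hu, mul_sub, Finset.sum_sub_distrib] at h1
  have h3 : ∑ j, ∑ l, (G u)⁻¹ j l * cov₂ G (ricci G) k l j u = pd k (scalar G) u := by
    rw [hG.pd_scalar hu]
    refine Finset.sum_congr rfl fun j _ => Finset.sum_congr rfl fun l _ => ?_
    rw [hG.cov₂_symm hu (fun v hv => hG.ricci_symm hv) k l j]
  have h4 : ∑ j, ∑ l, (G u)⁻¹ j l * cov₂ G (ricci G) l k j u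
      = ∑ m, ∑ i, (G u)⁻¹ m i * cov₂ G (ricci G) m i k u := by
    rw [Finset.sum_comm]
    refine Finset.sum_congr rfl fun m _ => Finset.sum_congr rfl fun i _ => ?_
    rw [hG.cov₂_symm hu (fun v hv => hG.ricci_symm hv) m k i, hG.inv_symm hu i m]
  rw [h3, h4] at h1
  linarith

end IsSmoothMetricOn

end CoordMetric

/-! ### Divergence of the Weyl tensor in terms of the Cotton tensor. -/

namespace CoordMetric

variable {n : ℕ}

/-- The Schouten tensor. -/
def schouten (G : EuclideanSpace ℝ (Fin n) → Matrix (Fin n) (Fin n) ℝ) (i j : Fin n)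
    (u : EuclideanSpace ℝ (Fin n)) : ℝ :=
  1 / ((n : ℝ) - 2) * (ricci G i j u - 1 / (2 * ((n : ℝ) - 1)) * (scalar G u * G u i j))

variable {G : EuclideanSpace ℝ (Fin n) → Matrix (Fin n) (Fin n) ℝ}
  {U : Set (EuclideanSpace ℝ (Fin n))} {u : EuclideanSpace ℝ (Fin n)}

/-- The scalar and trace-free Ricci parts merge into one product A ∧ g with the Schouten tensor A,
so only one product has to be differentiated. -/
theorem weyl_eq (hn : 4 ≤ n) (i j k l : Fin n) (u : EuclideanSpace ℝ (Fin n)) :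
    weyl G i j k l u
      = riemann G i j k l u - kulkarniNomizu (fun a b => schouten G a b u) (G u) i j k l := by
  have h4 : (4 : ℝ) ≤ n := mod_cast hn
  have h0 : (n : ℝ) ≠ 0 := by linarith
  have h1 : (n : ℝ) - 1 ≠ 0 := by linarith
  have h2 : (n : ℝ) - 2 ≠ 0 := by linarith
  unfold weyl kulkarniNomizu schouten tracelessRicci
  field_simp
  ring

namespace IsSmoothMetricOn

theorem contDiffAt_schouten (hG : IsSmoothMetricOn G U) (hu : u ∈ U) (i j : Fin n) :
    ContDiffAt ℝ ∞ (schouten G i j) u :=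
  contDiffAt_const.mul ((hG.contDiffAt_ricci hu i j).sub
    (contDiffAt_const.mul ((hG.contDiffAt_scalar hu).mul (hG.smooth u hu i j))))

theorem cov₂_schouten (hG : IsSmoothMetricOn G U) (hu : u ∈ U) (m i j : Fin n) :
    cov₂ G (schouten G) m i j u = 1 / ((n : ℝ) - 2) *
      (cov₂ G (ricci G) m i j u - 1 / (2 * ((n : ℝ) - 1)) * (pd m (scalar G) u * G u i j)) := by
  have hS := hG.contDiffAt_scalar hu
  have hg := hG.smooth u hu i j
  have hr := hG.contDiffAt_ricci hu i j
  have h1 : pd m (schouten G i j) u = 1 / ((n : ℝ) - 2) * (pd m (ricci G i j) u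
      - 1 / (2 * ((n : ℝ) - 1)) * (pd m (scalar G) u * G u i j
        + scalar G u * ∑ a, (christoffel G a m i u * G u a j + G u i a * christoffel G a m j u))) := by
    unfold schouten
    rw [pd_const_mul m _ (hr.sub (contDiffAt_const.mul (hS.mul hg))),
      pd_sub m hr (contDiffAt_const.mul (hS.mul hg)), pd_const_mul m _ (hS.mul hg),
      pd_mul m hS hg, hG.pd_metric hu]
  have h2 : ∑ a, (christoffel G a m i u * schouten G a j u
        + christoffel G a m j u * schouten G i a u)
      = 1 / ((n : ℝ) - 2) * (∑ a, (christoffel G a m i u * ricci G a j u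
          + christoffel G a m j u * ricci G i a u)
        - 1 / (2 * ((n : ℝ) - 1)) * (scalar G u
          * ∑ a, (christoffel G a m i u * G u a j + G u i a * christoffel G a m j u))) := by
    simp only [schouten, Finset.mul_sum, ← Finset.sum_sub_distrib]
    exact Finset.sum_congr rfl fun a _ => by ring
  unfold cov₂
  rw [h1, h2]
  ring

/-- D is a derivation on the Kulkarni-Nomizu product and Dg = 0: the derivative of g in A ∧ g is
cancelled by the connection terms falling on g. -/
theorem cov₄_weyl (hG : IsSmoothMetricOn G U) (hu : u ∈ U) (hn : 4 ≤ n) (m i j k l : Fin n) :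
    covWeyl G m i j k l u = cov₄ G (riemann G) m i j k l u
      - kulkarniNomizu (fun a b => cov₂ G (schouten G) m a b u) (G u) i j k l := by
  have hA := hG.contDiffAt_schouten hu
  have hg := hG.smooth u hu
  have hR := hG.contDiffAt_riemann hu i j k l
  have hAg (a b c d : Fin n) := (hA a b).mul (hg c d)
  have h1 : pd m (weyl G i j k l) u = pd m (riemann G i j k l) u
      - (kulkarniNomizu (fun a b => pd m (schouten G a b) u) (G u) i j k l
        + kulkarniNomizu (fun a b => schouten G a b u)
          (fun a b => ∑ c, (christoffel G c m a u * G u c b + G u a c * christoffel G c m b u))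
          i j k l) := by
    rw [funext (weyl_eq hn i j k l)]
    unfold kulkarniNomizu
    rw [pd_sub m hR ((((hAg i k j l).add (hAg j l i k)).sub (hAg i l j k)).sub (hAg j k i l)),
      pd_sub m (((hAg i k j l).add (hAg j l i k)).sub (hAg i l j k)) (hAg j k i l),
      pd_sub m ((hAg i k j l).add (hAg j l i k)) (hAg i l j k),
      pd_add m (hAg i k j l) (hAg j l i k),
      pd_mul m (hA _ _) (hg _ _), pd_mul m (hA _ _) (hg _ _), pd_mul m (hA _ _) (hg _ _),
      pd_mul m (hA _ _) (hg _ _)]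
    simp only [hG.pd_metric hu]
    ring
  have h2 : ∑ a, (christoffel G a m i u * weyl G a j k l u
        + christoffel G a m j u * weyl G i a k l u
        + christoffel G a m k u * weyl G i j a l u + christoffel G a m l u * weyl G i j k a u)
      = ∑ a, (christoffel G a m i u * riemann G a j k l u
        + christoffel G a m j u * riemann G i a k l u
        + christoffel G a m k u * riemann G i j a l u
        + christoffel G a m l u * riemann G i j k a u)
      - (kulkarniNomizu (fun a b => ∑ c, (christoffel G c m a u * schouten G c b u
            + christoffel G c m b u * schouten G a c u)) (G u) i j k l
        + kulkarniNomizu (fun a b => schouten G a b u)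
          (fun a b => ∑ c, (christoffel G c m a u * G u c b + G u a c * christoffel G c m b u))
          i j k l) := by
    simp only [weyl_eq hn, kulkarniNomizu, Finset.mul_sum, Finset.sum_mul,
      ← Finset.sum_sub_distrib, ← Finset.sum_add_distrib]
    exact Finset.sum_congr rfl fun a _ => by ring
  unfold covWeyl cov₄ cov₂
  rw [h1, h2]
  unfold kulkarniNomizu
  ring

theorem sum_inv_mul_mul_metric (hG : IsSmoothMetricOn G U) (hu : u ∈ U) (F : Fin n → ℝ)
    (k : Fin n) : ∑ m, ∑ i, (G u)⁻¹ m i * (F m * G u i k) = F k := by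
  calc _ = ∑ m, F m * ∑ i, (G u)⁻¹ m i * G u i k := by
        simp only [Finset.mul_sum]
        exact Finset.sum_congr rfl fun m _ => Finset.sum_congr rfl fun i _ => by ring
    _ = F k := by simp [hG.sum_inv_mul hu]

/-- By the contracted Bianchi identity the constant is (1/2 - 1/(2(n-1)))/(n-2) = 1/(2(n-1));
equivalently, div A = d(tr A). -/
theorem div_schouten (hG : IsSmoothMetricOn G U) (hu : u ∈ U) (hn : 4 ≤ n) (k : Fin n) :
    ∑ m, ∑ i, (G u)⁻¹ m i * cov₂ G (schouten G) m i k u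
      = 1 / (2 * ((n : ℝ) - 1)) * pd k (scalar G) u := by
  have h4 : (4 : ℝ) ≤ n := mod_cast hn
  have h1 : (n : ℝ) - 1 ≠ 0 := by linarith
  have h2 : (n : ℝ) - 2 ≠ 0 := by linarith
  calc _ = 1 / ((n : ℝ) - 2) * (∑ m, ∑ i, (G u)⁻¹ m i * cov₂ G (ricci G) m i k u
        - 1 / (2 * ((n : ℝ) - 1))
          * ∑ m, ∑ i, (G u)⁻¹ m i * (pd m (scalar G) u * G u i k)) := by
        simp only [hG.cov₂_schouten hu, Finset.mul_sum, ← Finset.sum_sub_distrib]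
        exact Finset.sum_congr rfl fun m _ => Finset.sum_congr rfl fun i _ => by ring
    _ = _ := by
        rw [hG.div_ricci hu, hG.sum_inv_mul_mul_metric hu fun m => pd m (scalar G) u]
        field_simp
        ring

/-- The divergence of the Weyl tensor is a multiple of the Cotton tensor. -/
theorem divWeyl_eq (hG : IsSmoothMetricOn G U) (hu : u ∈ U) (hn : 4 ≤ n) (j k l : Fin n) :
    divWeyl G j k l u = -(((n : ℝ) - 3) / ((n : ℝ) - 2)) *
      (cov₂ G (ricci G) k l j u - cov₂ G (ricci G) l k j u
        - 1 / (2 * ((n : ℝ) - 1))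
          * (pd k (scalar G) u * G u j l - pd l (scalar G) u * G u j k)) := by
  have h4 : (4 : ℝ) ≤ n := mod_cast hn
  have h1 : (n : ℝ) - 1 ≠ 0 := by linarith
  have h2 : (n : ℝ) - 2 ≠ 0 := by linarith
  have h3 : ∑ m, ∑ i, (G u)⁻¹ m i * covWeyl G m i j k l u
      = ∑ m, ∑ i, (G u)⁻¹ m i * cov₄ G (riemann G) m i j k l u
        - ((∑ m, ∑ i, (G u)⁻¹ m i * cov₂ G (schouten G) m i k u) * G u j l
          + ∑ m, ∑ i, (G u)⁻¹ m i * (cov₂ G (schouten G) m j l u * G u i k)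
          - (∑ m, ∑ i, (G u)⁻¹ m i * cov₂ G (schouten G) m i l u) * G u j k
          - ∑ m, ∑ i, (G u)⁻¹ m i * (cov₂ G (schouten G) m j k u * G u i l)) := by
    simp only [hG.cov₄_weyl hu hn, kulkarniNomizu, Finset.sum_mul, ← Finset.sum_sub_distrib,
      ← Finset.sum_add_distrib]
    exact Finset.sum_congr rfl fun m _ => Finset.sum_congr rfl fun i _ => by ring
  unfold divWeyl
  -- The divergence of R is n-2 times the skew derivative of A plus ds-terms; that of A ∧ g is the
  -- same skew derivative once, plus the same ds-terms. The difference carries the factor n-3.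
  rw [h3, hG.div_riemann hu, hG.div_schouten hu hn, hG.div_schouten hu hn,
    hG.sum_inv_mul_mul_metric hu fun m => cov₂ G (schouten G) m j l u,
    hG.sum_inv_mul_mul_metric hu fun m => cov₂ G (schouten G) m j k u,
    hG.cov₂_schouten hu, hG.cov₂_schouten hu,
    hG.cov₂_symm hu (fun v hv => hG.ricci_symm hv) k j l,
    hG.cov₂_symm hu (fun v hv => hG.ricci_symm hv) l j k]
  field_simp
  ring

/-! ### Curvature identities on a gradient soliton, in coordinates. -/

variable {φ : EuclideanSpace ℝ (Fin n) → ℝ}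

/-- The Ricci identity for the differential of a function. -/
theorem cov₂_hess_sub (hG : IsSmoothMetricOn G U) (hu : u ∈ U) (hφ : ContDiffAt ℝ ∞ φ u)
    (k l j : Fin n) :
    cov₂ G (hess G φ) k l j u - cov₂ G (hess G φ) l k j u
      = ∑ p, riemannUp G k l j p u * pd p φ u := by
  have hd (i : Fin n) := contDiffAt_pd i hφ
  have hΓ := hG.contDiffAt_christoffel hu
  have h1 (k l : Fin n) : pd k (hess G φ l j) u = pd k (pd l (pd j φ)) u
      - ∑ a, (pd k (christoffel G a l j) u * pd a φ u
        + christoffel G a l j u * pd k (pd a φ) u) := by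
    unfold hess
    rw [pd_sub k (contDiffAt_pd l (hd j)) (ContDiffAt.sum fun a _ => (hΓ a l j).mul (hd a)),
      pd_sum k fun a => (hΓ a l j).mul (hd a)]
    congr 1
    exact Finset.sum_congr rfl fun a _ => pd_mul k (hΓ a l j) (hd a)
  have h2 : ∑ a, christoffel G a k l u * hess G φ a j u
      = ∑ a, christoffel G a l k u * hess G φ a j u :=
    Finset.sum_congr rfl fun a _ => by rw [hG.christoffel_symm hu]
  have h3 (k l : Fin n) : ∑ a, christoffel G a k j u * hess G φ l a u
      = ∑ a, christoffel G a k j u * pd l (pd a φ) u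
        - ∑ p, ∑ a, christoffel G a k j u * christoffel G p l a u * pd p φ u := by
    rw [Finset.sum_comm, ← Finset.sum_sub_distrib]
    refine Finset.sum_congr rfl fun a _ => ?_
    unfold hess
    rw [mul_sub, Finset.mul_sum]
    simp only [mul_assoc]
  unfold cov₂ riemannUp
  simp only [h1, Finset.sum_add_distrib, Finset.sum_sub_distrib, h2, h3, add_mul, sub_mul,
    Finset.sum_mul, pd_comm k l (hd j)]
  ring

variable {ρ : ℝ}

/-- Apply D to the soliton equation; ρg is parallel. -/
theorem cov₂_ricci_eq_neg_cov₂_hess (hG : IsSmoothMetricOn G U) (hu : u ∈ U)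
    (hφ : ContDiffAt ℝ ∞ φ u)
    (hsol : ∀ v ∈ U, ∀ i j, ricci G i j v + hess G φ i j v = ρ * G v i j) (m i j : Fin n) :
    cov₂ G (ricci G) m i j u = -cov₂ G (hess G φ) m i j u := by
  have hr := hG.contDiffAt_ricci hu
  have hh : ContDiffAt ℝ ∞ (hess G φ i j) u :=
    (contDiffAt_pd i (contDiffAt_pd j hφ)).sub (ContDiffAt.sum fun a _ =>
      (hG.contDiffAt_christoffel hu a i j).mul (contDiffAt_pd a hφ))
  have h1 := pd_congr m hG.isOpen hu fun v hv => hsol v hv i j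
  rw [pd_add m (hr i j) hh, pd_const_mul m ρ (hG.smooth u hu i j), hG.pd_metric hu] at h1
  have h2 (a b : Fin n) : ricci G a b u = ρ * G u a b - hess G φ a b u := by
    linarith [hsol u hu a b]
  have h3 : ∑ a, (christoffel G a m i u * ricci G a j u + christoffel G a m j u * ricci G i a u)
      = ρ * ∑ a, (christoffel G a m i u * G u a j + G u i a * christoffel G a m j u)
        - ∑ a, (christoffel G a m i u * hess G φ a j u
          + christoffel G a m j u * hess G φ i a u) := by
    simp only [h2, Finset.mul_sum, ← Finset.sum_sub_distrib]
    exact Finset.sum_congr rfl fun a _ => by ring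
  unfold cov₂
  rw [h3]
  linarith

variable {y : Fin n → ℝ}

/-- On a gradient Ricci soliton the exterior derivative of the Ricci tensor is the contraction
of the curvature with the gradient `y` of the potential. -/
theorem cov₂_ricci_sub (hG : IsSmoothMetricOn G U) (hu : u ∈ U) (hφ : ContDiffAt ℝ ∞ φ u)
    (hsol : ∀ v ∈ U, ∀ i j, ricci G i j v + hess G φ i j v = ρ * G v i j)
    (hy : ∀ p, pd p φ u = ∑ q, G u p q * y q) (k l j : Fin n) :
    cov₂ G (ricci G) k l j u - cov₂ G (ricci G) l k j u = -∑ q, riemann G k l j q u * y q := by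
  rw [hG.cov₂_ricci_eq_neg_cov₂_hess hu hφ hsol, hG.cov₂_ricci_eq_neg_cov₂_hess hu hφ hsol,
    ← neg_sub', hG.cov₂_hess_sub hu hφ]
  unfold riemann
  simp only [hy, Finset.mul_sum, Finset.sum_mul]
  rw [Finset.sum_comm]
  simp only [mul_assoc]

/-- Trace `cov₂_ricci_sub` over l and j: the left side becomes ds - ds/2 by the contracted Bianchi
identity, the right side r(·,∇f). -/
theorem pd_scalar_soliton (hG : IsSmoothMetricOn G U) (hu : u ∈ U) (hφ : ContDiffAt ℝ ∞ φ u)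
    (hsol : ∀ v ∈ U, ∀ i j, ricci G i j v + hess G φ i j v = ρ * G v i j)
    (hy : ∀ p, pd p φ u = ∑ q, G u p q * y q) (k : Fin n) :
    pd k (scalar G) u = 2 * ∑ q, ricci G k q u * y q := by
  have h1 : ∑ l, ∑ j, (G u)⁻¹ l j * (cov₂ G (ricci G) k l j u - cov₂ G (ricci G) l k j u)
      = pd k (scalar G) u - 1 / 2 * pd k (scalar G) u := by
    simp only [mul_sub, Finset.sum_sub_distrib]
    rw [← hG.pd_scalar hu, ← hG.div_ricci hu]
    congr 1
    refine Finset.sum_congr rfl fun l _ => Finset.sum_congr rfl fun j _ => ?_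
    rw [hG.cov₂_symm hu fun v hv => hG.ricci_symm hv]
  have h2 : ∑ l, ∑ j, (G u)⁻¹ l j * (cov₂ G (ricci G) k l j u - cov₂ G (ricci G) l k j u)
      = ∑ q, ricci G k q u * y q := by
    simp only [hG.cov₂_ricci_sub hu hφ hsol hy, ← hG.sum_inv_mul_riemann hu k]
    simp only [Finset.sum_mul, ← Finset.sum_neg_distrib, Finset.mul_sum]
    calc _ = ∑ l, ∑ q, ∑ j, (G u)⁻¹ l j * -(riemann G k l j q u * y q) :=
          Finset.sum_congr rfl fun l _ => Finset.sum_comm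
      _ = ∑ q, ∑ l, ∑ j, (G u)⁻¹ l j * -(riemann G k l j q u * y q) := Finset.sum_comm
      _ = _ := by
          refine Finset.sum_congr rfl fun q _ => Finset.sum_congr rfl fun l _ =>
            Finset.sum_congr rfl fun j _ => ?_
          rw [hG.riemann_antisymm_right hu k l j q]
          ring
  linarith

/-- If the divergence of the Weyl tensor of a gradient Ricci soliton vanishes in the direction of
the gradient `y` of the potential, then the curvature contracted twice with `y` is determined by
the Ricci tensor. -/
theorem riemann_gradient_gradient (hG : IsSmoothMetricOn G U) (hu : u ∈ U) (hn : 4 ≤ n)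
    (hφ : ContDiffAt ℝ ∞ φ u)
    (hsol : ∀ v ∈ U, ∀ i j, ricci G i j v + hess G φ i j v = ρ * G v i j)
    (hy : ∀ p, pd p φ u = ∑ q, G u p q * y q)
    (hW : ∀ j k, ∑ l, divWeyl G j k l u * y l = 0) (k j : Fin n) :
    ∑ l, ∑ q, riemann G k l j q u * (y l * y q)
      = 1 / ((n : ℝ) - 1) * ((∑ l, ∑ q, ricci G l q u * (y l * y q)) * G u j k
        - (∑ q, ricci G k q u * y q) * ∑ l, G u j l * y l) := by
  have h4 : (4 : ℝ) ≤ n := mod_cast hn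
  have h1 : (n : ℝ) - 1 ≠ 0 := by linarith
  have h2 : (n : ℝ) - 2 ≠ 0 := by linarith
  have h3 : (n : ℝ) - 3 ≠ 0 := by linarith
  have h5 : ∑ l, divWeyl G j k l u * y l = (((n : ℝ) - 3) / ((n : ℝ) - 2)) *
      (∑ l, ∑ q, riemann G k l j q u * (y l * y q)
        - 1 / ((n : ℝ) - 1) * ((∑ l, ∑ q, ricci G l q u * (y l * y q)) * G u j k
        - (∑ q, ricci G k q u * y q) * ∑ l, G u j l * y l)) := by
    have h6 (l : Fin n) : divWeyl G j k l u * y l = (((n : ℝ) - 3) / ((n : ℝ) - 2)) *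
        (∑ q, riemann G k l j q u * (y l * y q)
          - 1 / ((n : ℝ) - 1) * ((∑ q, ricci G l q u * (y l * y q)) * G u j k
            - (∑ q, ricci G k q u * y q) * (G u j l * y l))) := by
      have h7 : ∑ q, riemann G k l j q u * (y l * y q)
          = y l * ∑ q, riemann G k l j q u * y q := by
        rw [Finset.mul_sum]
        exact Finset.sum_congr rfl fun q _ => by ring
      have h8 : ∑ q, ricci G l q u * (y l * y q) = y l * ∑ q, ricci G l q u * y q := by
        rw [Finset.mul_sum]
        exact Finset.sum_congr rfl fun q _ => by ring
      rw [hG.divWeyl_eq hu hn, hG.cov₂_ricci_sub hu hφ hsol hy,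
        hG.pd_scalar_soliton hu hφ hsol hy, hG.pd_scalar_soliton hu hφ hsol hy, h7, h8]
      field_simp
      ring
    simp only [h6]
    rw [← Finset.mul_sum, Finset.sum_sub_distrib, ← Finset.mul_sum, Finset.sum_sub_distrib,
      ← Finset.sum_mul, ← Finset.mul_sum]
  -- Since n ≥ 4, the factor (n-3)/(n-2) can be cancelled; in dimension three it would be zero.
  rw [hW, eq_comm, mul_eq_zero, or_iff_right (div_ne_zero h3 h2)] at h5
  linarith

end IsSmoothMetricOn

end CoordMetric

/-! ### From tangent vectors on the manifold to components in a chart. -/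

namespace RiemMfd

variable {n : ℕ} {M : Type*} [TopologicalSpace M] [ChartedSpace (EuclideanSpace ℝ (Fin n)) M]

section Charts

variable {e : OpenPartialHomeomorph M (EuclideanSpace ℝ (Fin n))}
  {u : EuclideanSpace ℝ (Fin n)}

theorem comp_smul (p : M) (c : ℝ) (X : TangentSpace (𝓡 n) p) (i : Fin n) :
    comp e p (c • X) i = c * comp e p X i := by
  unfold comp
  rw [map_smul]
  rfl

theorem comp_zero (p : M) (i : Fin n) : comp e p (0 : TangentSpace (𝓡 n) p) i = 0 := by
  unfold comp
  rw [map_zero]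
  rfl

theorem comp_sum (p : M) (X : Fin n → TangentSpace (𝓡 n) p) (i : Fin n) :
    comp e p (∑ a, X a) i = ∑ a, comp e p (X a) i := by
  unfold comp
  rw [map_sum]
  have h := map_sum (EuclideanSpace.proj i : EuclideanSpace ℝ (Fin n) →L[ℝ] ℝ)
    (fun a => (show EuclideanSpace ℝ (Fin n) from
      mfderiv (𝓡 n) 𝓘(ℝ, EuclideanSpace ℝ (Fin n)) e p (X a))) Finset.univ
  exact h

theorem mdifferentiable_chart (he : e ∈ IsManifold.maximalAtlas (𝓡 n) ∞ M) :
    e.MDifferentiable (𝓡 n) (𝓡 n) :=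
  ⟨(contMDiffOn_of_mem_maximalAtlas he).mdifferentiableOn (by simp),
    (contMDiffOn_symm_of_mem_maximalAtlas he).mdifferentiableOn (by simp)⟩

theorem comp_coordVec (he : e ∈ IsManifold.maximalAtlas (𝓡 n) ∞ M)
    (hu : u ∈ e.target) (i j : Fin n) :
    comp e (e.symm u) (coordVec e u i) j = if j = i then 1 else 0 := by
  have h := (mdifferentiable_chart he).comp_symm_deriv hu
  have h2 := DFunLike.congr_fun h (EuclideanSpace.single i 1)
  have h3 := congrArg (fun v : EuclideanSpace ℝ (Fin n) => v j) h2
  refine h3.trans ?_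
  change (EuclideanSpace.single i (1 : ℝ)) j = _
  rw [PiLp.single_apply]

theorem comp_ext (he : e ∈ IsManifold.maximalAtlas (𝓡 n) ∞ M) {p : M} (hp : p ∈ e.source)
    {X Y : TangentSpace (𝓡 n) p} (h : ∀ i, comp e p X i = comp e p Y i) : X = Y := by
  refine (mdifferentiable_chart he).mfderiv_injective hp ?_
  have h2 : (show EuclideanSpace ℝ (Fin n) from
      mfderiv (𝓡 n) 𝓘(ℝ, EuclideanSpace ℝ (Fin n)) e p X) = (show EuclideanSpace ℝ (Fin n) from
      mfderiv (𝓡 n) 𝓘(ℝ, EuclideanSpace ℝ (Fin n)) e p Y) := by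
    ext i
    exact h i
  exact h2

theorem comp_sum_smul_coordVec (he : e ∈ IsManifold.maximalAtlas (𝓡 n) ∞ M)
    (hu : u ∈ e.target) (x : Fin n → ℝ) (j : Fin n) :
    comp e (e.symm u) (∑ i, x i • coordVec e u i) j = x j := by
  simp [comp_sum, comp_smul, comp_coordVec he hu]

theorem sum_comp_smul_coordVec (he : e ∈ IsManifold.maximalAtlas (𝓡 n) ∞ M)
    (hu : u ∈ e.target) (X : TangentSpace (𝓡 n) (e.symm u)) :
    ∑ i, comp e (e.symm u) X i • coordVec e u i = X :=
  comp_ext he (e.map_target hu) fun j => comp_sum_smul_coordVec he hu _ j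

theorem contDiffAt_comp_symm (he : e ∈ IsManifold.maximalAtlas (𝓡 n) ∞ M) (hu : u ∈ e.target)
    {f : M → ℝ} (hf : ContMDiff (𝓡 n) 𝓘(ℝ, ℝ) ∞ f) :
    ContDiffAt ℝ ∞ (fun v => f (e.symm v)) u := by
  rw [← contMDiffAt_iff_contDiffAt]
  exact hf.contMDiffAt.comp u (contMDiffAt_symm_of_mem_maximalAtlas he hu)

theorem pd_comp_symm (he : e ∈ IsManifold.maximalAtlas (𝓡 n) ∞ M) (hu : u ∈ e.target)
    {f : M → ℝ} (hf : ContMDiff (𝓡 n) 𝓘(ℝ, ℝ) ∞ f) (i : Fin n) :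
    CoordMetric.pd i (fun v => f (e.symm v)) u
      = mfderiv (𝓡 n) 𝓘(ℝ, ℝ) f (e.symm u) (coordVec e u i) := by
  have h := mfderiv_comp (I := 𝓡 n) (I' := 𝓡 n) (I'' := 𝓘(ℝ, ℝ)) u
    ((hf (e.symm u)).mdifferentiableAt (by simp))
    ((mdifferentiable_chart he).mdifferentiableAt_symm hu)
  rw [mfderiv_eq_fderiv] at h
  exact DFunLike.congr_fun h (EuclideanSpace.single i 1)

/-- The coordinate field is the derivative of `e.symm` applied to a constant section. This gives
smoothness of the entries g_ij. -/
theorem contMDiffAt_coordVec [IsManifold (𝓡 n) ∞ M]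
    (he : e ∈ IsManifold.maximalAtlas (𝓡 n) ∞ M) (hu : u ∈ e.target)
    (i : Fin n) :
    ContMDiffAt (𝓡 n) ((𝓡 n).prod 𝓘(ℝ, EuclideanSpace ℝ (Fin n))) ∞
      (fun v => (⟨e.symm v, coordVec e v i⟩ :
        Bundle.TotalSpace (EuclideanSpace ℝ (Fin n)) (fun x : M => TangentSpace (𝓡 n) x))) u := by
  have : IsManifold (𝓡 n) 1 M := .of_le (n := ∞) (by simp)
  have hϕ : ContMDiffAt (𝓡 n) 𝓘(ℝ, EuclideanSpace ℝ (Fin n) →L[ℝ] EuclideanSpace ℝ (Fin n)) ∞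
      (inTangentCoordinates (𝓡 n) (𝓡 n) id e.symm (fun v => mfderiv (𝓡 n) (𝓡 n) e.symm v) u) u :=
    (contMDiffAt_symm_of_mem_maximalAtlas he hu).mfderiv_const (by simp)
  have hc : ContMDiffAt (𝓡 n) (𝓡 n).tangent ∞
      (fun v => (⟨v, (EuclideanSpace.single i 1 : EuclideanSpace ℝ (Fin n))⟩ :
        TangentBundle (𝓡 n) (EuclideanSpace ℝ (Fin n)))) u := by
    rw [Bundle.contMDiffAt_totalSpace]
    refine ⟨contMDiffAt_id, ?_⟩
    simpa using contMDiffAt_const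
  exact ContMDiffWithinAt.clm_apply_of_inCoordinates hϕ hc
    (contMDiffAt_symm_of_mem_maximalAtlas he hu)

end Charts

section Metric

variable [Bundle.RiemannianBundle (fun x : M => TangentSpace (𝓡 n) x)]
  {e : OpenPartialHomeomorph M (EuclideanSpace ℝ (Fin n))} {u : EuclideanSpace ℝ (Fin n)}

theorem inner_sum_smul_coordVec (x y : Fin n → ℝ) :
    inner ℝ (∑ i, x i • coordVec e u i) (∑ j, y j • coordVec e u j)
      = ∑ i, ∑ j, metricIn e u i j * (x i * y j) := by
  simp only [sum_inner, inner_sum, real_inner_smul_left, real_inner_smul_right, metricIn,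
    Matrix.of_apply]
  rw [Finset.sum_comm]
  exact Finset.sum_congr rfl fun i _ => Finset.sum_congr rfl fun j _ => by ring

theorem inner_eq_sum (he : e ∈ IsManifold.maximalAtlas (𝓡 n) ∞ M) (hu : u ∈ e.target)
    (X Y : TangentSpace (𝓡 n) (e.symm u)) :
    inner ℝ X Y = ∑ i, ∑ j, metricIn e u i j
      * (comp e (e.symm u) X i * comp e (e.symm u) Y j) := by
  rw [← inner_sum_smul_coordVec, sum_comp_smul_coordVec he hu, sum_comp_smul_coordVec he hu]

theorem inner_coordVec (he : e ∈ IsManifold.maximalAtlas (𝓡 n) ∞ M) (hu : u ∈ e.target)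
    (i : Fin n) (Y : TangentSpace (𝓡 n) (e.symm u)) :
    inner ℝ (coordVec e u i) Y = ∑ j, metricIn e u i j * comp e (e.symm u) Y j := by
  rw [inner_eq_sum he hu]
  simp [comp_coordVec he hu]

theorem isSmoothMetricOn_metricIn [IsManifold (𝓡 n) ∞ M]
    [IsContMDiffRiemannianBundle (𝓡 n) ∞ (EuclideanSpace ℝ (Fin n))
      (fun x : M => TangentSpace (𝓡 n) x)]
    (he : e ∈ IsManifold.maximalAtlas (𝓡 n) ∞ M) :
    CoordMetric.IsSmoothMetricOn (metricIn e) e.target where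
  isOpen := e.open_target
  smooth u hu i j := by
    rw [← contMDiffAt_iff_contDiffAt]
    exact ContMDiffAt.inner_bundle (contMDiffAt_coordVec he hu i) (contMDiffAt_coordVec he hu j)
  symm u _ i j := real_inner_comm (coordVec e u j) (coordVec e u i)
  -- A kernel vector of (g_ij) would be the component vector of a tangent vector of length zero.
  det_ne_zero u hu h := by
    obtain ⟨x, hx, h⟩ := Matrix.exists_mulVec_eq_zero_iff.2 h
    refine hx (funext fun j => ?_)
    have h2 : inner ℝ (∑ i, x i • coordVec e u i) (∑ j, x j • coordVec e u j) = 0 := by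
      rw [inner_sum_smul_coordVec]
      refine Finset.sum_eq_zero fun i _ => ?_
      have h3 := congrFun h i
      rw [Matrix.mulVec, dotProduct, Pi.zero_apply] at h3
      calc _ = x i * ∑ j, metricIn e u i j * x j := by
            rw [Finset.mul_sum]
            exact Finset.sum_congr rfl fun j _ => by ring
        _ = 0 := by rw [h3, mul_zero]
    rw [inner_self_eq_zero] at h2
    rw [← comp_sum_smul_coordVec he hu x j, h2, comp_zero, Pi.zero_apply]

theorem inner_grad (f : M → ℝ) (p : M) (X : TangentSpace (𝓡 n) p) :
    inner ℝ X (grad f p) = mfderiv (𝓡 n) 𝓘(ℝ, ℝ) f p X := by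
  have : FiniteDimensional ℝ (TangentSpace (𝓡 n) p) :=
    inferInstanceAs (FiniteDimensional ℝ (EuclideanSpace ℝ (Fin n)))
  have : CompleteSpace (TangentSpace (𝓡 n) p) := FiniteDimensional.complete ℝ _
  rw [real_inner_comm]
  exact InnerProductSpace.toDual_symm_apply

/-- Supplies the hypothesis `hy` of the coordinate identities: the components of ∇f are df with its
index raised. -/
theorem pd_eq_sum_grad (he : e ∈ IsManifold.maximalAtlas (𝓡 n) ∞ M) (hu : u ∈ e.target)
    {f : M → ℝ} (hf : ContMDiff (𝓡 n) 𝓘(ℝ, ℝ) ∞ f) (i : Fin n) :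
    CoordMetric.pd i (fun v => f (e.symm v)) u
      = ∑ j, metricIn e u i j * comp e (e.symm u) (grad f (e.symm u)) j := by
  rw [pd_comp_symm he hu hf, ← inner_coordVec he hu, inner_grad]

end Metric

end RiemMfd

/-! ### The radial curvature identity on the manifold. -/

namespace RiemMfd

variable {n : ℕ} {M : Type*} [TopologicalSpace M] [ChartedSpace (EuclideanSpace ℝ (Fin n)) M]
  [Bundle.RiemannianBundle (fun x : M => TangentSpace (𝓡 n) x)]
  {e : OpenPartialHomeomorph M (EuclideanSpace ℝ (Fin n))} {u : EuclideanSpace ℝ (Fin n)}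

theorem ricci_smul_smul (p : M) (c d : ℝ) (X Y : TangentSpace (𝓡 n) p) :
    ricci e p (c • X) (d • Y) = c * d * ricci e p X Y := by
  simp only [ricci, comp_smul, Finset.mul_sum]
  exact Finset.sum_congr rfl fun i _ => Finset.sum_congr rfl fun j _ => by ring

theorem ricci_zero_right (p : M) (X : TangentSpace (𝓡 n) p) : ricci e p X 0 = 0 := by
  simp [ricci, comp_zero]

theorem riemann_eq_sum (hu : u ∈ e.target) (X Y Z : TangentSpace (𝓡 n) (e.symm u)) :
    riemann e (e.symm u) X Z Y Z = ∑ k, ∑ j,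
      (∑ l, ∑ q, CoordMetric.riemann (metricIn e) k l j q u
          * (comp e (e.symm u) Z l * comp e (e.symm u) Z q))
        * (comp e (e.symm u) X k * comp e (e.symm u) Y j) := by
  unfold riemann
  rw [e.right_inv hu]
  refine Finset.sum_congr rfl fun k _ => ?_
  rw [Finset.sum_comm]
  refine Finset.sum_congr rfl fun j _ => ?_
  simp only [Finset.sum_mul]
  exact Finset.sum_congr rfl fun l _ => Finset.sum_congr rfl fun q _ => by ring

variable [IsManifold (𝓡 n) ∞ M]

theorem riemann_symm [IsContMDiffRiemannianBundle (𝓡 n) ∞ (EuclideanSpace ℝ (Fin n))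
      (fun x : M => TangentSpace (𝓡 n) x)]
    (he : e ∈ IsManifold.maximalAtlas (𝓡 n) ∞ M) (hu : u ∈ e.target)
    (X Y Z : TangentSpace (𝓡 n) (e.symm u)) :
    riemann e (e.symm u) X Z Y Z = riemann e (e.symm u) Y Z X Z := by
  rw [riemann_eq_sum hu, riemann_eq_sum hu, Finset.sum_comm]
  refine Finset.sum_congr rfl fun j _ => Finset.sum_congr rfl fun k _ => ?_
  rw [mul_comm (comp e _ X k)]
  congr 1
  rw [Finset.sum_comm]
  refine Finset.sum_congr rfl fun q _ => Finset.sum_congr rfl fun l _ => ?_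
  rw [(isSmoothMetricOn_metricIn he).riemann_pair_symm hu k l j q, mul_comm (comp e _ Z l)]

/-- The curvature in the direction of the gradient on a gradient Ricci soliton with
`δW(·, ·, ∇f) = 0`. -/
theorem riemann_grad_grad [IsContMDiffRiemannianBundle (𝓡 n) ∞ (EuclideanSpace ℝ (Fin n))
      (fun x : M => TangentSpace (𝓡 n) x)] (hn : 4 ≤ n)
    {f : M → ℝ} (hf : ContMDiff (𝓡 n) 𝓘(ℝ, ℝ) ∞ f) {ρ : ℝ}
    (hsol : IsGradientRicciSoliton n f ρ) (hW : IsWeaklyHarmonicWeyl n f)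
    (he : e ∈ IsManifold.maximalAtlas (𝓡 n) ∞ M) (hu : u ∈ e.target)
    (X Y : TangentSpace (𝓡 n) (e.symm u)) :
    riemann e (e.symm u) X (grad f (e.symm u)) Y (grad f (e.symm u))
      = 1 / ((n : ℝ) - 1) *
        (ricci e (e.symm u) (grad f (e.symm u)) (grad f (e.symm u)) * inner ℝ X Y
          - ricci e (e.symm u) X (grad f (e.symm u)) * inner ℝ Y (grad f (e.symm u))) := by
  -- Evaluate on coordinate fields. The soliton equation is needed on the whole chart domain because
  -- it gets differentiated; the condition on δW is needed only at `u`.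
  have hsol' : ∀ v ∈ e.target, ∀ i j, CoordMetric.ricci (metricIn e) i j v
      + CoordMetric.hess (metricIn e) (fun v => f (e.symm v)) i j v = ρ * metricIn e v i j := by
    intro v hv i j
    have h := hsol e he (e.symm v) (e.map_target hv) (coordVec e v i) (coordVec e v j)
    unfold ricci hess at h
    rw [e.right_inv hv] at h
    refine Eq.trans ?_ h
    simp [comp_coordVec he hv]
  have hW' : ∀ j k, ∑ l, CoordMetric.divWeyl (metricIn e) j k l u
      * comp e (e.symm u) (grad f (e.symm u)) l = 0 := by
    intro j k
    have h := hW e he (e.symm u) (e.map_target hu) (coordVec e u j) (coordVec e u k)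
    unfold divWeyl at h
    rw [e.right_inv hu] at h
    simpa [comp_coordVec he hu] using h
  rw [riemann_eq_sum hu, real_inner_comm, inner_eq_sum he hu, inner_eq_sum he hu]
  simp only [(isSmoothMetricOn_metricIn he).riemann_gradient_gradient hu hn
    (contDiffAt_comp_symm he hu hf) hsol' (pd_eq_sum_grad he hu hf) hW']
  unfold ricci
  rw [e.right_inv hu]
  set y := comp e (e.symm u) (grad f (e.symm u))
  set x := comp e (e.symm u) X
  set z := comp e (e.symm u) Y
  set r := ∑ l, ∑ q, CoordMetric.ricci (metricIn e) l q u * (y l * y q)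
  have h1 : (∑ k, ∑ q, CoordMetric.ricci (metricIn e) k q u * (x k * y q))
        * ∑ j, ∑ l, metricIn e u j l * (z j * y l)
      = ∑ k, ∑ j, ((∑ q, CoordMetric.ricci (metricIn e) k q u * y q)
          * ∑ l, metricIn e u j l * y l) * (x k * z j) := by
    have h2 (k : Fin n) : ∑ q, CoordMetric.ricci (metricIn e) k q u * (x k * y q)
        = x k * ∑ q, CoordMetric.ricci (metricIn e) k q u * y q := by
      rw [Finset.mul_sum]
      exact Finset.sum_congr rfl fun q _ => by ring
    have h3 (j : Fin n) : ∑ l, metricIn e u j l * (z j * y l)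
        = z j * ∑ l, metricIn e u j l * y l := by
      rw [Finset.mul_sum]
      exact Finset.sum_congr rfl fun q _ => by ring
    simp only [h2, h3]
    rw [Finset.sum_mul_sum]
    exact Finset.sum_congr rfl fun k _ => Finset.sum_congr rfl fun j _ => by ring
  rw [h1, Finset.sum_comm (f := fun i j => metricIn e u i j * (z i * x j))]
  simp only [Finset.mul_sum _ _ r,
    ← Finset.sum_sub_distrib, Finset.mul_sum _ _ (1 / ((n : ℝ) - 1))]
  exact Finset.sum_congr rfl fun k _ => Finset.sum_congr rfl fun j _ => by ring

end RiemMfd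

end

theorem mainTheorem5 {n : ℕ} (hn : 4 ≤ n) {M : Type*} [EMetricSpace M]
    [ChartedSpace (EuclideanSpace ℝ (Fin n)) M] [IsManifold (𝓡 n) ∞ M]
    [Bundle.RiemannianBundle (fun x : M => TangentSpace (𝓡 n) x)]
    [IsContMDiffRiemannianBundle (𝓡 n) ∞ (EuclideanSpace ℝ (Fin n))
      (fun x : M => TangentSpace (𝓡 n) x)]
    [IsRiemannianManifold (𝓡 n) M] [CompleteSpace M]
    (f : M → ℝ) (hf : ContMDiff (𝓡 n) 𝓘(ℝ, ℝ) ∞ f) (ρ : ℝ) (hρ : 0 < ρ)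
    (hsol : RiemMfd.IsGradientRicciSoliton n f ρ)
    (hW : RiemMfd.IsWeaklyHarmonicWeyl n f) :
    ∀ e ∈ IsManifold.maximalAtlas (𝓡 n) ∞ M, ∀ p ∈ e.source,
      (∀ X : TangentSpace (𝓡 n) p, inner ℝ X (RiemMfd.grad f p) = 0 →
        RiemMfd.ricci e p X (RiemMfd.grad f p) = 0) ∧
      (∀ X Y : TangentSpace (𝓡 n) p, ‖X‖ = 1 → ‖Y‖ = 1 → inner ℝ X Y = 0 →
        inner ℝ X (RiemMfd.grad f p) = 0 → inner ℝ Y (RiemMfd.grad f p) = 0 →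
        RiemMfd.riemann e p X (RiemMfd.grad f p) Y (RiemMfd.grad f p) = 0) ∧
      (∀ X : TangentSpace (𝓡 n) p, ‖X‖ = 1 → inner ℝ X (RiemMfd.grad f p) = 0 →
        RiemMfd.riemann e p X (RiemMfd.grad f p) X (RiemMfd.grad f p)
            = 1 / ((n : ℝ) - 1) * RiemMfd.ricci e p (RiemMfd.grad f p) (RiemMfd.grad f p) ∧
        1 / ((n : ℝ) - 1) * RiemMfd.ricci e p (RiemMfd.grad f p) (RiemMfd.grad f p)
            = RiemMfd.radialRicci e f p * ‖(RiemMfd.grad f p : TangentSpace (𝓡 n) p)‖ ^ 2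
              / ((n : ℝ) - 1)) := by
  intro e he p hp
  obtain ⟨u, hu, rfl⟩ : ∃ u ∈ e.target, e.symm u = p := ⟨e p, e.map_source hp, e.left_inv hp⟩
  have hn1 : (n : ℝ) - 1 ≠ 0 := by
    have : (4 : ℝ) ≤ n := mod_cast hn
    linarith
  have hR := RiemMfd.riemann_grad_grad hn hf hsol hW he hu
  have hS := fun X Y => RiemMfd.riemann_symm he hu X Y (RiemMfd.grad f (e.symm u))
  -- Here `N` is ∇f itself, not the unit vector.
  set N : TangentSpace (𝓡 n) (e.symm u) := RiemMfd.grad f (e.symm u) with hN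
  refine ⟨fun X hX => ?_, fun X Y _ _ hXY _ hY => ?_, fun X hX hXN => ⟨?_, ?_⟩⟩
  · by_cases h0 : N = 0
    · rw [h0, RiemMfd.ricci_zero_right]
    · have h := hS X N
      rw [hR, hR, hX, real_inner_comm X N, hX, mul_zero, sub_self, mul_zero, zero_sub,
        mul_eq_zero, or_iff_right (one_div_ne_zero hn1), neg_eq_zero, mul_eq_zero,
        or_iff_left (inner_self_ne_zero.2 h0)] at h
      exact h
  · rw [hR, hXY, hY]
    ring
  · rw [hR, hXN, real_inner_self_eq_norm_sq, hX]
    ring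
  · by_cases h0 : N = 0
    · rw [h0, RiemMfd.ricci_zero_right, norm_zero]
      ring
    · have h : ‖N‖ ≠ 0 := norm_ne_zero_iff.2 h0
      -- Bilinearity: α carries the factor |∇f|⁻², which cancels against |∇f|² away from critical
      -- points.
      rw [RiemMfd.radialRicci, ← hN, RiemMfd.ricci_smul_smul]
      field_simp
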